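/- Let $d\in\mathbb N$ and $0<\alpha\le 1$. For normed spaces $E,F$ let $\mathcal C^{1+\alpha}(E;F)$ be the space of bounded continuously differentiable functions whose derivative is bounded and Hölder continuous with exponent $\alpha$, with norm $\|f\|=\sup|f|+\sup|\nabla f|+|\nabla f|_\alpha$, where $|g|_\alpha=\sup_{x\ne y}|g(x)-g(y)|/|x-y|^\alpha$; write $\mathcal C^{1+\alpha}(E)=\mathcal C^{1+\alpha}(E;\mathbb R)$. Let $\mathcal C^{2+\alpha}(\mathbb R;F)$ be the set of twice continuously differentiable functions that are bounded together with their first two derivatives and whose second derivative is Hölder continuous with exponent $\alpha$. Let $\mathcal M(\mathbb R^d)$ be the space of bounded signed Radon measures on $\mathbb R^d$, identified with a subspace of $(\mathcal C^{1+\alpha}(\mathbb R^d))^*$ through integration, and let $\mathcal Z$ be its closure in $(\mathcal C^{1+\alpha}(\mathbb R^d))^*$ for the dual norm. A curve $\nu_\bullet:[0,\infty)\to\mathcal M(\mathbb R^d)$ is narrowly continuous if $t\mapsto\int f\,d\nu_t$ is continuous for every bounded continuous $f$. Let $v_0\in\mathcal C^{2+\alpha}(\mathbb R;\mathbb R^d)$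 and $m_0\in\mathcal C^{2+\alpha}(\mathbb R;\mathbb R)$. For $u\in\{v_0,m_0\}$ let $K_u:\mathbb R^d\times\mathbb R^d\to\mathbb R$ be such that $x\mapsto K_u(\cdot,x)$ belongs to $\mathcal C^{1+\alpha}(\mathbb R^d;\mathcal C^{1+\alpha}(\mathbb R^d))$ and such that, for every $\psi\in(\mathcal C^{1+\alpha}(\mathbb R^d))^*$, the function $y\mapsto\langle K_u(y,\cdot),\psi\rangle$ is continuous and bounded. For $\zeta\in\mathcal Z$ put $k^u_\zeta(x)=\langle K_u(\cdot,x),\zeta\rangle$, which is $\int K_u(y,x)\,d\zeta(y)$ if $\zeta$ is a measure. Let $\mu_0\in\mathcal M(\mathbb R^d)$. *Linear problem.* Given $b:[0,\infty)\times\mathbb R^d\to\mathbb R^d$ and $w:[0,\infty)\times\mathbb R^d\to\mathbb R$, a weak solution of $\partial_t\nu_t+\mathrm{div}_x(b\,\nu_t)=w\,\nu_t$ with initial datum $\mu_0$ is a narrowly continuous curve $\nu_\bullet:[0,\infty)\to\mathcal M(\mathbb R^d)$ such that $$\int_0^\infty\!\!\int_{\mathbb R^d}\big(\partial_t\varphi(t,x)+b(t,x)\cdot\nabla_x\varphi(t,x)\big)\,d\nu_t(x)\,dt+\int_{\mathbb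 R^d}\varphi(0,x)\,d\mu_0(x)=-\int_0^\infty\!\!\int_{\mathbb R^d}w(t,x)\varphi(t,x)\,d\nu_t(x)\,dt$$ for all $\varphi\in\mathcal C_c^\infty([0,\infty)\times\mathbb R^d)$. *Non-linear problem.* A weak solution of $\partial_t\nu_t+\mathrm{div}_x(v_0(k^{v_0}_{\nu_t})\,\nu_t)=m_0(k^{m_0}_{\nu_t})\,\nu_t$ with initial datum $\mu_0$ is a narrowly continuous curve $\nu_\bullet:[0,\infty)\to\mathcal M(\mathbb R^d)$ which satisfies the same identity with $b(t,x)=v_0(k^{v_0}_{\nu_t}(x))$ and $w(t,x)=m_0(k^{m_0}_{\nu_t}(x))$ for all $\varphi\in\mathcal C_c^1([0,\infty)\times\mathbb R^d)$. *Operators.* $B$ sends a curve $\zeta_\bullet:[0,\infty)\to\mathcal Z$ to the pair of coefficients $b(t,x)=v_0(k^{v_0}_{\zeta_t}(x))$, $w(t,x)=m_0(k^{m_0}_{\zeta_t}(x))$. $S$ sends a pair $(b,w)$ for which the linear problem with initial datum $\mu_0$ has exactly one weak solution to that solution, seen as a curve in $\mathcal Z$. Let $\mathcal T=S\circ B$.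 **Proposition 4.1.** A curve $\nu_\bullet:[0,\infty)\to\mathcal M(\mathbb R^d)$ is a weak solution of the non-linear problem with initial datum $\mu_0$ if and only if $\nu_\bullet\in\mathcal C([0,\infty);\mathcal Z)$, $\nu_0=\mu_0$, and $\nu_\bullet$ is a fixed point of $\mathcal T$ (that is, $\mathcal T(\nu_\bullet)$ is defined and $\mathcal T(\nu_\bullet)=\nu_\bullet$). -/

import Mathlib

open MeasureTheory
open scoped NNReal ContDiff BoundedContinuousFunction

namespace NonlinearTransport

/-! ### The Hölder spaces -/

/-- `f ∈ C^{1+α}(E; F)`: `f` is continuously differentiable, `f` and its derivative are bounded, and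
the derivative is Hölder continuous with exponent `α`. -/
structure IsC1Holder {E F : Type*} [NormedAddCommGroup E] [NormedSpace ℝ E]
    [NormedAddCommGroup F] [NormedSpace ℝ F] (α : ℝ) (f : E → F) : Prop where
  contDiff : ContDiff ℝ 1 f
  bounded : ∃ C : ℝ, ∀ x, ‖f x‖ ≤ C
  bounded_fderiv : ∃ C : ℝ, ∀ x, ‖fderiv ℝ f x‖ ≤ C
  holder_fderiv : ∃ C : ℝ, ∀ x y, ‖fderiv ℝ f x - fderiv ℝ f y‖ ≤ C * ‖x - y‖ ^ α

/-- `f ∈ C^{2+α}(ℝ; F)`: `f` is twice continuously differentiable, `f`, `f'` and `f''` are bounded,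
and `f''` is Hölder continuous with exponent `α`. -/
structure IsC2Holder {F : Type*} [NormedAddCommGroup F] [NormedSpace ℝ F]
    (α : ℝ) (f : ℝ → F) : Prop where
  contDiff : ContDiff ℝ 2 f
  bounded : ∃ C : ℝ, ∀ s, ‖f s‖ ≤ C
  bounded_deriv : ∃ C : ℝ, ∀ s, ‖deriv f s‖ ≤ C
  bounded_deriv_two : ∃ C : ℝ, ∀ s, ‖deriv (deriv f) s‖ ≤ C
  holder_deriv_two : ∃ C : ℝ, ∀ s t,
    ‖deriv (deriv f) s - deriv (deriv f) t‖ ≤ C * |s - t| ^ α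

section HolderSpace

variable {α : ℝ} {E F G : Type*} [NormedAddCommGroup E] [NormedSpace ℝ E]
  [NormedAddCommGroup F] [NormedSpace ℝ F] [NormedAddCommGroup G] [NormedSpace ℝ G]

theorem IsC1Holder.differentiable {f : E → F} (hf : IsC1Holder α f) : Differentiable ℝ f :=
  hf.contDiff.differentiable (by norm_num)

theorem IsC1Holder.zero : IsC1Holder α (0 : E → F) where
  contDiff := contDiff_const
  bounded := ⟨0, fun x => by simp⟩
  bounded_fderiv := ⟨0, fun x => by simp⟩
  holder_fderiv := ⟨0, fun x y => by simp⟩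

theorem IsC1Holder.add {f g : E → F} (hf : IsC1Holder α f) (hg : IsC1Holder α g) :
    IsC1Holder α (f + g) := by
  have hd : ∀ x, fderiv ℝ (f + g) x = fderiv ℝ f x + fderiv ℝ g x := fun x =>
    fderiv_add (hf.differentiable x) (hg.differentiable x)
  obtain ⟨A, hA⟩ := hf.bounded
  obtain ⟨B, hB⟩ := hg.bounded
  obtain ⟨A', hA'⟩ := hf.bounded_fderiv
  obtain ⟨B', hB'⟩ := hg.bounded_fderiv
  obtain ⟨A'', hA''⟩ := hf.holder_fderiv
  obtain ⟨B'', hB''⟩ := hg.holder_fderiv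
  refine ⟨hf.contDiff.add hg.contDiff, ⟨A + B, fun x => ?_⟩, ⟨A' + B', fun x => ?_⟩,
    ⟨A'' + B'', fun x y => ?_⟩⟩
  · exact (norm_add_le _ _).trans (add_le_add (hA x) (hB x))
  · rw [hd]
    exact (norm_add_le _ _).trans (add_le_add (hA' x) (hB' x))
  · rw [hd, hd, add_sub_add_comm, add_mul]
    exact (norm_add_le _ _).trans (add_le_add (hA'' x y) (hB'' x y))

theorem IsC1Holder.clm_comp (L : F →L[ℝ] G) {f : E → F} (hf : IsC1Holder α f) :
    IsC1Holder α (fun x => L (f x)) := by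
  have hd : ∀ x, fderiv ℝ (fun x => L (f x)) x = L.comp (fderiv ℝ f x) := fun x =>
    (L.hasFDerivAt.comp x (hf.differentiable x).hasFDerivAt).fderiv
  obtain ⟨A, hA⟩ := hf.bounded
  obtain ⟨A', hA'⟩ := hf.bounded_fderiv
  obtain ⟨A'', hA''⟩ := hf.holder_fderiv
  refine ⟨L.contDiff.comp hf.contDiff, ⟨‖L‖ * A, fun x => ?_⟩, ⟨‖L‖ * A', fun x => ?_⟩,
    ⟨‖L‖ * A'', fun x y => ?_⟩⟩
  · exact (L.le_opNorm _).trans (mul_le_mul_of_nonneg_left (hA x) (norm_nonneg _))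
  · rw [hd]
    exact (L.opNorm_comp_le _).trans (mul_le_mul_of_nonneg_left (hA' x) (norm_nonneg _))
  · rw [hd, hd, ← ContinuousLinearMap.comp_sub, mul_assoc]
    exact (L.opNorm_comp_le _).trans (mul_le_mul_of_nonneg_left (hA'' x y) (norm_nonneg _))

theorem IsC1Holder.smul (c : ℝ) {f : E → F} (hf : IsC1Holder α f) : IsC1Holder α (c • f) :=
  hf.clm_comp (c • ContinuousLinearMap.id ℝ F)

/-- `C^{1+α}(E; F)` as a linear space of functions. -/
def holderSubmodule (α : ℝ) (E F : Type*) [NormedAddCommGroup E] [NormedSpace ℝ E]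
    [NormedAddCommGroup F] [NormedSpace ℝ F] :
    Submodule ℝ (E → F) where
  carrier := {f | IsC1Holder α f}
  add_mem' := IsC1Holder.add
  zero_mem' := IsC1Holder.zero
  smul_mem' c _ hf := hf.smul c

/-- The Hölder space `C^{1+α}(E; F)`, which is given its own norm below. -/
def HolderSpace (α : ℝ) (E F : Type*) [NormedAddCommGroup E] [NormedSpace ℝ E]
    [NormedAddCommGroup F] [NormedSpace ℝ F] : Type _ := ↥(holderSubmodule α E F)

instance : AddCommGroup (HolderSpace α E F) :=
  inferInstanceAs (AddCommGroup ↥(holderSubmodule α E F))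

instance : Module ℝ (HolderSpace α E F) := inferInstanceAs (Module ℝ ↥(holderSubmodule α E F))

instance : FunLike (HolderSpace α E F) E F where
  coe f := f.1
  coe_injective _ _ h := Subtype.ext h

theorem HolderSpace.isC1Holder (f : HolderSpace α E F) : IsC1Holder α ⇑f := f.2

/-- A function with the defining properties, as an element of `C^{1+α}(E; F)`. -/
def HolderSpace.mk (f : E → F) (hf : IsC1Holder α f) : HolderSpace α E F :=
  (⟨f, hf⟩ : ↥(holderSubmodule α E F))

theorem HolderSpace.coe_mk (f : E → F) (hf : IsC1Holder α f) : ⇑(HolderSpace.mk f hf) = f := rfl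

theorem HolderSpace.coe_zero : ⇑(0 : HolderSpace α E F) = 0 := rfl

theorem HolderSpace.coe_add (f g : HolderSpace α E F) : ⇑(f + g) = ⇑f + ⇑g := rfl

theorem HolderSpace.coe_smul (c : ℝ) (f : HolderSpace α E F) : ⇑(c • f) = c • ⇑f := rfl

/-- `‖f‖ = sup |f| + sup |∇f| + |∇f|_α`. Pairs with equal entries contribute `0` to the Hölder
supremum. -/
noncomputable instance : Norm (HolderSpace α E F) where
  norm f := (⨆ x, ‖f x‖) + (⨆ x, ‖fderiv ℝ f x‖) +
    ⨆ p : E × E, ‖fderiv ℝ f p.1 - fderiv ℝ f p.2‖ / ‖p.1 - p.2‖ ^ α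

theorem HolderSpace.norm_def (f : HolderSpace α E F) :
    ‖f‖ = (⨆ x, ‖f x‖) + (⨆ x, ‖fderiv ℝ f x‖) +
      ⨆ p : E × E, ‖fderiv ℝ f p.1 - fderiv ℝ f p.2‖ / ‖p.1 - p.2‖ ^ α := rfl

theorem HolderSpace.bddAbove_norm (f : HolderSpace α E F) :
    BddAbove (Set.range fun x => ‖f x‖) := by
  obtain ⟨C, hC⟩ := f.isC1Holder.bounded
  exact ⟨C, by rintro _ ⟨x, rfl⟩; exact hC x⟩

theorem HolderSpace.bddAbove_norm_fderiv (f : HolderSpace α E F) :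
    BddAbove (Set.range fun x => ‖fderiv ℝ f x‖) := by
  obtain ⟨C, hC⟩ := f.isC1Holder.bounded_fderiv
  exact ⟨C, by rintro _ ⟨x, rfl⟩; exact hC x⟩

theorem HolderSpace.bddAbove_holder (f : HolderSpace α E F) :
    BddAbove (Set.range fun p : E × E =>
      ‖fderiv ℝ f p.1 - fderiv ℝ f p.2‖ / ‖p.1 - p.2‖ ^ α) := by
  obtain ⟨C, hC⟩ := f.isC1Holder.holder_fderiv
  refine ⟨max C 0, ?_⟩
  rintro _ ⟨p, rfl⟩
  refine div_le_of_le_mul₀ (by positivity) (le_max_right _ _) ((hC p.1 p.2).trans ?_)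
  gcongr
  exact le_max_left _ _

theorem HolderSpace.norm_apply_le (f : HolderSpace α E F) (x : E) : ‖f x‖ ≤ ‖f‖ := by
  have h1 : ‖f x‖ ≤ ⨆ x, ‖f x‖ := le_ciSup f.bddAbove_norm x
  have h2 : 0 ≤ ⨆ x, ‖fderiv ℝ f x‖ := Real.iSup_nonneg fun x => norm_nonneg _
  have h3 : 0 ≤ ⨆ p : E × E, ‖fderiv ℝ f p.1 - fderiv ℝ f p.2‖ / ‖p.1 - p.2‖ ^ α :=
    Real.iSup_nonneg fun p => by positivity
  rw [HolderSpace.norm_def]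
  linarith

theorem HolderSpace.core : NormedSpace.Core ℝ (HolderSpace α E F) where
  norm_nonneg f := (norm_nonneg _).trans (f.norm_apply_le 0)
  norm_smul c f := by
    have hd : ∀ x, fderiv ℝ (c • ⇑f) x = c • fderiv ℝ f x := fun x =>
      fderiv_const_smul (f.isC1Holder.differentiable x) c
    simp only [HolderSpace.norm_def, HolderSpace.coe_smul, hd, Pi.smul_apply, ← smul_sub, norm_smul,
      mul_div_assoc, ← Real.mul_iSup_of_nonneg (norm_nonneg c), mul_add]
  norm_triangle f g := by
    have hd : ∀ x, fderiv ℝ (⇑f + ⇑g) x = fderiv ℝ f x + fderiv ℝ g x := fun x =>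
      fderiv_add (f.isC1Holder.differentiable x) (g.isC1Holder.differentiable x)
    have h1 : (⨆ x, ‖(f + g) x‖) ≤ (⨆ x, ‖f x‖) + ⨆ x, ‖g x‖ := ciSup_le fun x =>
      (norm_add_le _ _).trans
        (add_le_add (le_ciSup f.bddAbove_norm x) (le_ciSup g.bddAbove_norm x))
    have h2 : (⨆ x, ‖fderiv ℝ (⇑f + ⇑g) x‖) ≤ (⨆ x, ‖fderiv ℝ f x‖) + ⨆ x, ‖fderiv ℝ g x‖ :=
      ciSup_le fun x => by
        rw [hd]
        exact (norm_add_le _ _).trans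
          (add_le_add (le_ciSup f.bddAbove_norm_fderiv x) (le_ciSup g.bddAbove_norm_fderiv x))
    have h3 : (⨆ p : E × E, ‖fderiv ℝ (⇑f + ⇑g) p.1 - fderiv ℝ (⇑f + ⇑g) p.2‖ / ‖p.1 - p.2‖ ^ α) ≤
        (⨆ p : E × E, ‖fderiv ℝ f p.1 - fderiv ℝ f p.2‖ / ‖p.1 - p.2‖ ^ α) +
        ⨆ p : E × E, ‖fderiv ℝ g p.1 - fderiv ℝ g p.2‖ / ‖p.1 - p.2‖ ^ α :=
      ciSup_le fun p => by
        refine le_trans ?_ (add_le_add (le_ciSup f.bddAbove_holder p) (le_ciSup g.bddAbove_holder p))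
        rw [hd, hd, add_sub_add_comm, ← add_div]
        gcongr
        exact norm_add_le _ _
    simp only [HolderSpace.norm_def, HolderSpace.coe_add] at *
    linarith
  norm_eq_zero_iff f := by
    constructor
    · intro h
      refine DFunLike.ext _ _ fun x => ?_
      have := f.norm_apply_le x
      rw [h] at this
      exact norm_le_zero_iff.1 this
    · rintro rfl
      simp [HolderSpace.norm_def, HolderSpace.coe_zero]

noncomputable instance : NormedAddCommGroup (HolderSpace α E F) :=
  NormedAddCommGroup.ofCore HolderSpace.core

noncomputable instance : NormedSpace ℝ (HolderSpace α E F) := NormedSpace.ofCore HolderSpace.core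

/-- Evaluation at a point, as a continuous linear map on `C^{1+α}(E; F)`. -/
noncomputable def HolderSpace.eval (y : E) : HolderSpace α E F →L[ℝ] F :=
  LinearMap.mkContinuous
    { toFun := fun f => f y
      map_add' := fun _ _ => rfl
      map_smul' := fun _ _ => rfl } 1
    fun f => by rw [one_mul]; exact f.norm_apply_le y

/-- For a kernel `K ∈ C^{1+α}(E; C^{1+α}(E))`, thought of as `x ↦ K(·, x)`, this is the function
`K(y, ·) : x ↦ K(y, x)`, which is an element of `C^{1+α}(E)`. -/
noncomputable def kernelSection (K : HolderSpace α E (HolderSpace α E ℝ)) (y : E) :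
    HolderSpace α E ℝ :=
  HolderSpace.mk (fun x => K x y) (K.isC1Holder.clm_comp (HolderSpace.eval y))

/-- For every `ψ` in the dual space of `C^{1+α}(E)`, the function `y ↦ ⟨K(y, ·), ψ⟩` is continuous
and bounded. -/
def IsWeaklyContinuousBounded (K : HolderSpace α E (HolderSpace α E ℝ)) : Prop :=
  ∀ ψ : HolderSpace α E ℝ →L[ℝ] ℝ,
    Continuous (fun y => ψ (kernelSection K y)) ∧ ∃ C : ℝ, ∀ y, |ψ (kernelSection K y)| ≤ C

end HolderSpace

/-! ### Measures and the space `Z` -/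

/-- The Euclidean space `ℝ^d`. -/
abbrev Rd (d : ℕ) : Type := EuclideanSpace ℝ (Fin d)

/-- The bounded signed Radon measures on `ℝ^d` (a finite Borel measure on `ℝ^d` is Radon). -/
abbrev M (d : ℕ) : Type := SignedMeasure (Rd d)

variable {d : ℕ} {α : ℝ}

theorem isFiniteMeasure_variation (μ : M d) : IsFiniteMeasure μ.variation := by
  rw [← SignedMeasure.totalVariation_eq_variation]
  infer_instance

theorem HolderSpace.integrable (μ : M d) (f : HolderSpace α (Rd d) ℝ) : μ.Integrable ⇑f := by
  have := isFiniteMeasure_variation μ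
  exact Integrable.of_bound f.isC1Holder.contDiff.continuous.aestronglyMeasurable ‖f‖
    (Filter.Eventually.of_forall f.norm_apply_le)

/-- The embedding of the measures into `(C^{1+α}(ℝ^d))^*`: a measure is identified with integration
against it. -/
noncomputable def toDual (α : ℝ) (μ : M d) : HolderSpace α (Rd d) ℝ →L[ℝ] ℝ :=
  LinearMap.mkContinuous
    { toFun := fun f => ∫ᵛ x, f x ∂•μ
      map_add' := fun f g => VectorMeasure.integral_add (f.integrable μ) (g.integrable μ)
      map_smul' := fun c f => VectorMeasure.integral_fun_smul μ _ c ⇑f }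
    (‖ContinuousLinearMap.lsmul ℝ ℝ (E := ℝ)‖ * μ.variation.real Set.univ)
    fun f => by
      have := isFiniteMeasure_variation μ
      refine (VectorMeasure.norm_integral_le_of_norm_le_const
        (Filter.Eventually.of_forall f.norm_apply_le)).trans (le_of_eq ?_)
      ring

/-- The space `Z`: the closure of the measures in `(C^{1+α}(ℝ^d))^*`. Its topology is the one of the
dual norm. -/
abbrev Z (α : ℝ) (d : ℕ) : Type :=
  ↥(closure (Set.range (toDual α : M d → HolderSpace α (Rd d) ℝ →L[ℝ] ℝ)))

/-- A measure as an element of `Z`. -/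
noncomputable def measureToZ (α : ℝ) (μ : M d) : Z α d := ⟨toDual α μ, subset_closure ⟨μ, rfl⟩⟩

/-! ### Weak solutions of transport equations -/

/-- Narrow continuity of a curve of measures. -/
def IsNarrowlyContinuous (ν : ℝ≥0 → M d) : Prop :=
  ∀ f : Rd d →ᵇ ℝ, Continuous fun t => ∫ᵛ x, f x ∂•(ν t)

/-- The weak form of `∂ₜν + div(b ν) = w ν`, `ν₀ = μ₀`, against the test functions in
`C_c^n([0,∞) × ℝ^d)`. These are the restrictions of the compactly supported `C^n` functions on
`ℝ × ℝ^d`. In the first integral, the two terms are `∂ₜφ(t, x)` and `b(t, x) · ∇ₓφ(t, x)`. -/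
def SatisfiesWeakForm (n : WithTop ℕ∞) (b : ℝ≥0 → Rd d → Rd d) (w : ℝ≥0 → Rd d → ℝ)
    (μ₀ : M d) (ν : ℝ≥0 → M d) : Prop :=
  ∀ φ : ℝ × Rd d → ℝ, ContDiff ℝ n φ → HasCompactSupport φ →
    (∫ t in Set.Ioi (0 : ℝ), ∫ᵛ x,
        (fderiv ℝ φ (t, x) (1, 0) + fderiv ℝ φ (t, x) (0, b t.toNNReal x)) ∂•(ν t.toNNReal))
      + ∫ᵛ x, φ (0, x) ∂•μ₀
      = - ∫ t in Set.Ioi (0 : ℝ), ∫ᵛ x, (w t.toNNReal x * φ (t, x)) ∂•(ν t.toNNReal)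

/-- Weak solutions of the linear problem `∂ₜν + div(b ν) = w ν`, `ν₀ = μ₀`. The test functions are
smooth. -/
def IsLinearWeakSolution (b : ℝ≥0 → Rd d → Rd d) (w : ℝ≥0 → Rd d → ℝ)
    (μ₀ : M d) (ν : ℝ≥0 → M d) : Prop :=
  IsNarrowlyContinuous ν ∧ SatisfiesWeakForm ∞ b w μ₀ ν

/-- `k_μ(x) = ∫ K(y, x) dμ(y)` for a measure `μ`. -/
noncomputable def kernelIntegral (K : HolderSpace α (Rd d) (HolderSpace α (Rd d) ℝ)) (μ : M d)
    (x : Rd d) : ℝ :=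
  ∫ᵛ y, K x y ∂•μ

/-- Weak solutions of the non-linear problem `∂ₜν + div(v(k_ν) ν) = m(k_ν) ν`, `ν₀ = μ₀`. The test
functions are of class `C^1`. -/
def IsNonlinearWeakSolution (v : ℝ → Rd d) (m : ℝ → ℝ)
    (Kv Km : HolderSpace α (Rd d) (HolderSpace α (Rd d) ℝ)) (μ₀ : M d) (ν : ℝ≥0 → M d) : Prop :=
  IsNarrowlyContinuous ν ∧
    SatisfiesWeakForm 1 (fun t x => v (kernelIntegral Kv (ν t) x))
      (fun t x => m (kernelIntegral Km (ν t) x)) μ₀ ν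

/-! ### The operators `B`, `S` and `T = S ∘ B` -/

/-- `k_ζ(x) = ⟨K(·, x), ζ⟩` for `ζ ∈ Z`. -/
noncomputable def kernelPairing (K : HolderSpace α (Rd d) (HolderSpace α (Rd d) ℝ)) (ζ : Z α d) (x : Rd d) : ℝ :=
  ζ.1 (K x)

/-- The operator `B`, which sends a curve `ζ` in `Z` to the coefficients
`b(t, x) = v(k_{ζ_t}(x))` and `w(t, x) = m(k_{ζ_t}(x))`. -/
noncomputable def opB (v : ℝ → Rd d) (m : ℝ → ℝ) (Kv Km : HolderSpace α (Rd d) (HolderSpace α (Rd d) ℝ))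
    (ζ : ℝ≥0 → Z α d) : (ℝ≥0 → Rd d → Rd d) × (ℝ≥0 → Rd d → ℝ) :=
  (fun t x => v (kernelPairing Kv (ζ t) x), fun t x => m (kernelPairing Km (ζ t) x))

/-- The operator `S`, which sends coefficients `(b, w)` to the weak solution of the linear problem
with initial datum `μ₀`, seen as a curve in `Z`. It is defined at those coefficients for which there
is exactly one weak solution. -/
noncomputable def opS (α : ℝ) (μ₀ : M d) (bw : (ℝ≥0 → Rd d → Rd d) × (ℝ≥0 → Rd d → ℝ)) :
    Part (ℝ≥0 → Z α d) where
  Dom := ∃! ν : ℝ≥0 → M d, IsLinearWeakSolution bw.1 bw.2 μ₀ ν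
  get h := fun t => measureToZ α (h.choose t)

/-- The operator `T = S ∘ B`. The statement `opT v m Kv Km μ₀ ζ = Part.some ζ` says that `T` is
defined at the curve `ζ` and that `ζ` is a fixed point of `T`. -/
noncomputable def opT (v : ℝ → Rd d) (m : ℝ → ℝ)
    (Kv Km : HolderSpace α (Rd d) (HolderSpace α (Rd d) ℝ)) (μ₀ : M d) (ζ : ℝ≥0 → Z α d) :
    Part (ℝ≥0 → Z α d) :=
  opS α μ₀ (opB v m Kv Km ζ)

end NonlinearTransport

open NonlinearTransport

/-! Once a curve `ν` is fixed, the non-linear equation is a linear equation whose coefficients are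
computed from `ν`, so both sides of the equivalence concern the same linear problem. They differ in
the class of test functions, in the topology on curves, and in the demand that the linear problem
have exactly one solution.

Mollification passes from smooth to `C^1` test functions (`SatisfiesWeakForm.of_smooth`). It needs
total masses that are locally bounded in time, which narrow continuity provides through
Banach–Steinhaus (`IsNarrowlyContinuous.exists_totalMass_le`). A du Bois-Reymond argument turns the
weak form into an identity at every time (`SatisfiesWeakForm.hasEvolution`). This identity yields
the initial value and, after a spatial cutoff, a local Lipschitz bound in the dual norm
(`HasEvolution.norm_toDual_sub_le`), hence continuity in `Z`.

Uniqueness for the linear problem is a duality argument that avoids the flow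
(`HasEvolution.eq_zero`). On a short time step, the backward dual equation is solved approximately
by an explicit Euler step with coefficients frozen in time: the residual is small and the `C^1`
bound grows only by a factor `1 + O(h)`, so a discrete Gronwall inequality annihilates the
difference of two solutions. The coefficients must be `C^1` in space and uniformly continuous in
time for the sup norm; this is where continuity in `Z` enters (`isC1Coeff_kernel`).

Conversely, a fixed point in `Z` is the linear solution itself, because measures embed injectively
(`measureToZ_injective`). -/

namespace NonlinearTransport

open Set Filter Topology

/-! ### Signed measures, total mass and narrow continuity -/

section Measures

variable {d : ℕ}

instance (μ : M d) : IsFiniteMeasure μ.variation := isFiniteMeasure_variation μ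

/-- The total mass of the variation of a signed measure. -/
noncomputable def totalMass (μ : M d) : ℝ := μ.variation.real univ

theorem totalMass_nonneg (μ : M d) : 0 ≤ totalMass μ := measureReal_nonneg

theorem integrable_of_bound (μ : M d) {f : Rd d → ℝ} {C : ℝ} (hf : Continuous f)
    (hC : ∀ x, |f x| ≤ C) : μ.Integrable f :=
  Integrable.of_bound hf.aestronglyMeasurable C (Eventually.of_forall hC)

theorem integrable_of_hasCompactSupport (μ : M d) {f : Rd d → ℝ} (hf : Continuous f)
    (hc : HasCompactSupport f) : μ.Integrable f :=
  hf.integrable_of_hasCompactSupport hc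

theorem abs_integral_le (μ : M d) {f : Rd d → ℝ} {C : ℝ} (hC : ∀ x, |f x| ≤ C) :
    |∫ᵛ x, f x ∂•μ| ≤ C * totalMass μ := by
  have := VectorMeasure.norm_integral_le_of_norm_le_const (μ := μ)
    (B := ContinuousLinearMap.lsmul ℝ ℝ) (Eventually.of_forall hC)
  simpa [totalMass] using this

theorem abs_integral_le_integral_abs (μ : M d) (f : Rd d → ℝ) :
    |∫ᵛ x, f x ∂•μ| ≤ ∫ x, |f x| ∂μ.variation := by
  have := VectorMeasure.norm_integral_le_integral_norm (μ := μ) (f := f)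
    (B := ContinuousLinearMap.lsmul ℝ ℝ)
  simpa using this

theorem integral_indicator_one (μ : M d) {s : Set (Rd d)} (hs : MeasurableSet s) :
    ∫ᵛ x, s.indicator (fun _ => (1 : ℝ)) x ∂•μ = μ s := by
  simp [VectorMeasure.integral_indicator_const (μ := μ) (1 : ℝ) hs]

/-- The sign function of a Hahn decomposition attains the total mass. -/
theorem exists_integral_eq_totalMass (μ : M d) : ∃ f : Rd d → ℝ, Measurable f ∧
    (∀ x, |f x| ≤ 1) ∧ ∫ᵛ x, f x ∂•μ = totalMass μ := by
  obtain ⟨i, hi, hi2, hi3, hp, hn⟩ := μ.toJordanDecomposition_spec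
  have h1 : μ.Integrable (i.indicator fun _ => (1 : ℝ)) :=
    (integrable_const (1 : ℝ)).indicator hi
  have h2 : μ.Integrable (iᶜ.indicator fun _ => (1 : ℝ)) :=
    (integrable_const (1 : ℝ)).indicator hi.compl
  refine ⟨fun x => i.indicator (fun _ => (1 : ℝ)) x - iᶜ.indicator (fun _ => (1 : ℝ)) x,
    (measurable_const.indicator hi).sub (measurable_const.indicator hi.compl), fun x => ?_, ?_⟩
  · by_cases hx : x ∈ i <;> simp [hx]
  · rw [VectorMeasure.integral_fun_sub h1 h2, integral_indicator_one μ hi,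
      integral_indicator_one μ hi.compl, totalMass, ← SignedMeasure.totalVariation_eq_variation,
      SignedMeasure.totalVariation, measureReal_add_apply, hp, hn,
      SignedMeasure.toMeasureOfZeroLE_real_apply _ _ _ MeasurableSet.univ,
      SignedMeasure.toMeasureOfLEZero_real_apply _ _ _ MeasurableSet.univ]
    simp [sub_eq_add_neg]

/-- The Hahn sign function is approximated in `L^1` of the variation by a bounded continuous
function. Truncating to `[-1, 1]` does not move it away from the sign function, whose values already
lie there. -/
theorem totalMass_le_of_forall (μ : M d) {C : ℝ}
    (h : ∀ f : Rd d →ᵇ ℝ, ‖f‖ ≤ 1 → ∫ᵛ x, f x ∂•μ ≤ C) : totalMass μ ≤ C := by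
  obtain ⟨s, hsm, hs1, hs⟩ := exists_integral_eq_totalMass μ
  have hsi : μ.Integrable s :=
    Integrable.of_bound hsm.aestronglyMeasurable 1 (Eventually.of_forall hs1)
  refine le_of_forall_pos_le_add fun ε hε => ?_
  obtain ⟨g, hg, hgi⟩ := hsi.exists_boundedContinuous_integral_sub_le hε
  have hcl : ∀ x, |max (-1) (min 1 (g x))| ≤ 1 := fun x =>
    abs_le.2 ⟨le_max_left _ _, max_le (by norm_num) (min_le_left _ _)⟩
  let f : Rd d →ᵇ ℝ := BoundedContinuousFunction.ofNormedAddCommGroup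
    (fun x => max (-1) (min 1 (g x))) (by fun_prop) 1 hcl
  have hf1 : ‖f‖ ≤ 1 := (BoundedContinuousFunction.norm_le zero_le_one).2 hcl
  have hfi : μ.Integrable f := integrable_of_bound μ f.continuous hcl
  have hle : ∀ x, |s x - f x| ≤ |s x - g x| := by
    intro x
    have hsx := abs_le.1 (hs1 x)
    change |s x - max (-1) (min 1 (g x))| ≤ _
    rcases le_total (g x) 1 with h1 | h1 <;> rcases le_total (-1) (g x) with h2 | h2
    · simp [h1, h2]
    · rw [min_eq_right h1, max_eq_left h2, abs_of_nonneg (by linarith), abs_of_nonneg (by linarith)]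
      linarith
    · rw [min_eq_left h1, max_eq_right (by norm_num), abs_of_nonpos (by linarith),
        abs_of_nonpos (by linarith)]
      linarith
    · linarith
  have key : |∫ᵛ x, (s x - f x) ∂•μ| ≤ ε := by
    refine (abs_integral_le_integral_abs μ _).trans (le_trans ?_ hg)
    exact integral_mono (hsi.sub hfi).abs (hsi.sub hgi).norm hle
  rw [VectorMeasure.integral_fun_sub hsi hfi, hs] at key
  linarith [(abs_le.1 key).2, h f hf1]

/-- Indicators are `L^1` limits, for the variation of `μ - ν`, of smooth compactly supported
functions. -/
theorem eq_of_forall_integral_contDiff_eq {μ ν : M d}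
    (h : ∀ ψ : Rd d → ℝ, ContDiff ℝ ∞ ψ → HasCompactSupport ψ →
      ∫ᵛ x, ψ x ∂•μ = ∫ᵛ x, ψ x ∂•ν) : μ = ν := by
  rw [← sub_eq_zero]
  set σ : M d := μ - ν with hσ
  have h0 : ∀ ψ : Rd d → ℝ, ContDiff ℝ ∞ ψ → HasCompactSupport ψ → ∫ᵛ x, ψ x ∂•σ = 0 := by
    intro ψ h1 h2
    rw [hσ, VectorMeasure.integral_sub_vectorMeasure
      (integrable_of_hasCompactSupport μ h1.continuous h2)
      (integrable_of_hasCompactSupport ν h1.continuous h2), h ψ h1 h2, sub_self]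
  ext s hs
  have hsi : σ.Integrable (s.indicator fun _ => (1 : ℝ)) :=
    (integrable_const (1 : ℝ)).indicator hs
  rw [← integral_indicator_one σ hs]
  change _ = (0 : ℝ)
  refine abs_nonpos_iff.1 (le_of_forall_pos_le_add fun ε hε => ?_)
  obtain ⟨g, hg1, hg2, hg3⟩ := (memLp_one_iff_integrable.2 hsi).exist_eLpNorm_sub_le
    (by norm_num) le_rfl hε
  have hgi := integrable_of_hasCompactSupport σ hg2.continuous hg1
  have e : ∫ᵛ x, s.indicator (fun _ => (1 : ℝ)) x ∂•σ =
      ∫ᵛ x, (s.indicator (fun _ => (1 : ℝ)) x - g x) ∂•σ := by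
    rw [VectorMeasure.integral_fun_sub hsi hgi, h0 g hg2 hg1, sub_zero]
  rw [e, zero_add]
  refine (abs_integral_le_integral_abs σ _).trans ?_
  have := integral_norm_eq_lintegral_enorm (hsi.sub hgi).aestronglyMeasurable
  simp only [Real.norm_eq_abs, Pi.sub_apply] at this
  rw [this]
  rw [eLpNorm_one_eq_lintegral_enorm] at hg3
  exact ENNReal.toReal_le_of_le_ofReal hε.le hg3

/-- Banach–Steinhaus on the bounded continuous functions: each pairing is continuous in time, hence
bounded on `[0, T]`, so the functionals are uniformly bounded. -/
theorem IsNarrowlyContinuous.exists_totalMass_le {ν : ℝ≥0 → M d} (h : IsNarrowlyContinuous ν)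
    (T : ℝ≥0) : ∃ V : ℝ, ∀ t ≤ T, totalMass (ν t) ≤ V := by
  have hint : ∀ (t : ℝ≥0) (f : Rd d →ᵇ ℝ), (ν t).Integrable f := fun t f =>
    integrable_of_bound _ f.continuous f.norm_coe_le_norm
  let L : Icc 0 T → (Rd d →ᵇ ℝ) →L[ℝ] ℝ := fun t =>
    LinearMap.mkContinuous
      { toFun := fun f => ∫ᵛ x, f x ∂•(ν t)
        map_add' := fun f g => VectorMeasure.integral_fun_add (hint _ f) (hint _ g)
        map_smul' := fun c f => VectorMeasure.integral_fun_smul _ _ c f }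
      (totalMass (ν t)) fun f => by
        rw [mul_comm]
        exact abs_integral_le _ f.norm_coe_le_norm
  obtain ⟨V, hV⟩ := banach_steinhaus (g := L) fun f => by
    obtain ⟨C, hC⟩ := isCompact_Icc.exists_bound_of_continuousOn (s := Icc 0 T) (h f).continuousOn
    exact ⟨C, fun t => hC t t.2⟩
  refine ⟨V, fun t ht => totalMass_le_of_forall _ fun f hf => ?_⟩
  have h1 := (L ⟨t, zero_le, ht⟩).le_of_opNorm_le (hV _) f
  have h2 : 0 ≤ V := (norm_nonneg _).trans (hV ⟨t, zero_le, ht⟩)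
  calc ∫ᵛ x, f x ∂•(ν t) ≤ ‖L ⟨t, zero_le, ht⟩ f‖ := le_abs_self _
    _ ≤ V * ‖f‖ := h1
    _ ≤ V * 1 := by gcongr
    _ = V := mul_one V

/-- With the integrand frozen at `t₀` this is narrow continuity. The remainder `g t - g t₀` is
uniformly small on the compact `K` and is paired with measures of locally bounded mass. -/
theorem IsNarrowlyContinuous.continuous_integral {ν : ℝ≥0 → M d} (h : IsNarrowlyContinuous ν)
    {g : ℝ≥0 → Rd d → ℝ} (hg : Continuous fun p : ℝ≥0 × Rd d => g p.1 p.2) {K : Set (Rd d)}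
    (hK : IsCompact K) (hgK : ∀ t, ∀ x ∉ K, g t x = 0) :
    Continuous fun t => ∫ᵛ x, g t x ∂•(ν t) := by
  have hgt : ∀ t, Continuous (g t) := fun t => hg.comp (by fun_prop : Continuous fun x => (t, x))
  have hgc : ∀ t, HasCompactSupport (g t) := fun t => HasCompactSupport.intro hK (hgK t)
  have hgi : ∀ s t, (ν s).Integrable (g t) := fun s t =>
    integrable_of_hasCompactSupport _ (hgt t) (hgc t)
  rw [continuous_iff_continuousAt]
  intro t₀
  obtain ⟨V, hV⟩ := h.exists_totalMass_le (t₀ + 1)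
  obtain ⟨C, hC⟩ := (hgc t₀).exists_bound_of_continuous (hgt t₀)
  have h1 : Tendsto (fun t => ∫ᵛ x, g t₀ x ∂•(ν t)) (𝓝 t₀) (𝓝 (∫ᵛ x, g t₀ x ∂•(ν t₀))) :=
    (h (BoundedContinuousFunction.ofNormedAddCommGroup (g t₀) (hgt t₀) C hC)).tendsto t₀
  have h2 : Tendsto (fun t => ∫ᵛ x, (g t x - g t₀ x) ∂•(ν t)) (𝓝 t₀) (𝓝 0) := by
    rw [Metric.tendsto_nhds]
    intro ε hε
    have hV0 : 0 ≤ V := (totalMass_nonneg _).trans (hV t₀ (by simp))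
    have hU : ∀ᶠ t in 𝓝 t₀, ∀ x ∈ K, |g t x - g t₀ x| < ε / (V + 1) := by
      refine hK.eventually_forall_of_forall_eventually fun x _ => ?_
      have hc : Continuous fun p : ℝ≥0 × Rd d => |g p.1 p.2 - g t₀ p.2| := by
        have := (hgt t₀).comp (continuous_snd (X := ℝ≥0) (Y := Rd d))
        exact (hg.sub this).abs
      have := hc.tendsto (t₀, x)
      simp only [sub_self, abs_zero] at this
      exact this.eventually (gt_mem_nhds (by positivity))
    have hT : ∀ᶠ t in 𝓝 t₀, t < t₀ + 1 := gt_mem_nhds (by simp)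
    filter_upwards [hU, hT] with t ht htT
    rw [dist_zero_right, Real.norm_eq_abs]
    have hb : ∀ x, |g t x - g t₀ x| ≤ ε / (V + 1) := by
      intro x
      by_cases hx : x ∈ K
      · exact (ht x hx).le
      · rw [hgK t x hx, hgK t₀ x hx, sub_self, abs_zero]
        positivity
    calc |∫ᵛ x, (g t x - g t₀ x) ∂•(ν t)| ≤ ε / (V + 1) * totalMass (ν t) := abs_integral_le _ hb
      _ ≤ ε / (V + 1) * V := by gcongr; exact hV t htT.le
      _ < ε := by
        rw [div_mul_eq_mul_div, div_lt_iff₀ (by positivity)]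
        nlinarith
  have h3 := h2.add h1
  rw [zero_add] at h3
  refine h3.congr fun t => ?_
  rw [VectorMeasure.integral_fun_sub (hgi t t) (hgi t t₀), sub_add_cancel]

theorem IsNarrowlyContinuous.sub {ν ν' : ℝ≥0 → M d} (h : IsNarrowlyContinuous ν)
    (h' : IsNarrowlyContinuous ν') : IsNarrowlyContinuous fun t => ν t - ν' t := by
  intro f
  refine ((h f).sub (h' f)).congr fun t => ?_
  exact (VectorMeasure.integral_sub_vectorMeasure
    (integrable_of_bound _ f.continuous f.norm_coe_le_norm)
    (integrable_of_bound _ f.continuous f.norm_coe_le_norm)).symm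

end Measures

/-! ### Smooth approximation of `C^1` test functions -/

section Mollification

open scoped Convolution

/-- Convolution with a normalized bump commutes with the derivative, so uniform continuity of `φ`
and of its derivative gives both estimates. -/
theorem exists_contDiff_infty_approx {E : Type*} [NormedAddCommGroup E] [NormedSpace ℝ E]
    [FiniteDimensional ℝ E] {φ : E → ℝ} (hφ : ContDiff ℝ 1 φ) (hc : HasCompactSupport φ)
    {ε : ℝ} (hε : 0 < ε) : ∃ g : E → ℝ, ContDiff ℝ ∞ g ∧
      tsupport g ⊆ Metric.cthickening 1 (tsupport φ) ∧ (∀ x, |g x - φ x| ≤ ε) ∧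
      ∀ x, ‖fderiv ℝ g x - fderiv ℝ φ x‖ ≤ ε := by
  borelize E
  let μ : Measure E := Measure.addHaar
  have hu := hc.uniformContinuous_of_continuous hφ.continuous
  have hd := hφ.continuous_fderiv one_ne_zero
  have hu' := (hc.fderiv ℝ).uniformContinuous_of_continuous hd
  obtain ⟨δ, hδ, h1⟩ := Metric.uniformContinuous_iff.1 hu ε hε
  obtain ⟨δ', hδ', h2⟩ := Metric.uniformContinuous_iff.1 hu' ε hε
  -- The bound by 1 keeps the support in the thickening of radius 1; `δ` and `δ'` are the moduli of
  -- `φ` and its derivative.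
  set r : ℝ := min 1 (min δ δ') with hr
  have hr0 : 0 < r := by positivity
  let ρ : ContDiffBump (0 : E) := ⟨r / 2, r, half_pos hr0, half_lt_self hr0⟩
  have hρ : LocallyIntegrable (ρ.normed μ) μ := ρ.continuous_normed.locallyIntegrable
  have hlip : ∀ x, HasFDerivAt (ρ.normed μ ⋆[ContinuousLinearMap.lsmul ℝ ℝ, μ] φ)
      ((ρ.normed μ ⋆[ContinuousLinearMap.lsmul ℝ ℝ, μ] fderiv ℝ φ) x) x := fun x =>
    hc.hasFDerivAt_convolution_right (ContinuousLinearMap.lsmul ℝ ℝ) hρ hφ x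
  refine ⟨ρ.normed μ ⋆[ContinuousLinearMap.lsmul ℝ ℝ, μ] φ,
    ρ.hasCompactSupport_normed.contDiff_convolution_left _ ρ.contDiff_normed
      hφ.continuous.locallyIntegrable, ?_, fun x => ?_, fun x => ?_⟩
  · refine closure_minimal (fun x hx => ?_) Metric.isClosed_cthickening
    by_contra hx'
    have hz : ∀ y ∈ Metric.ball x r, φ y = 0 := by
      intro y hy
      by_contra hy'
      refine hx' (Metric.mem_cthickening_of_dist_le x y 1 _ (subset_tsupport φ hy') ?_)
      rw [dist_comm]
      exact (Metric.mem_ball.1 hy).le.trans (min_le_left _ _)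
    have h0 : φ x = 0 := hz x (Metric.mem_ball_self hr0)
    -- Error zero is admissible because `φ` vanishes on the whole ball that the convolution sees.
    have := ρ.dist_normed_convolution_le (μ := μ) (g := φ) (x₀ := x) (ε := 0)
      hφ.continuous.aestronglyMeasurable fun y hy => by rw [hz y hy, h0, dist_self]
    rw [h0, dist_zero_right] at this
    exact hx (norm_le_zero_iff.1 this)
  · rw [← Real.norm_eq_abs, ← dist_eq_norm]
    exact ρ.dist_normed_convolution_le hφ.continuous.aestronglyMeasurable fun y hy =>
      (h1 ((Metric.mem_ball.1 hy).trans_le ((min_le_right _ _).trans (min_le_left _ _)))).le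
  · rw [(hlip x).fderiv, ← dist_eq_norm]
    exact ρ.dist_normed_convolution_le hd.aestronglyMeasurable fun y hy =>
      (h2 ((Metric.mem_ball.1 hy).trans_le ((min_le_right _ _).trans (min_le_right _ _)))).le

end Mollification

/-! ### The weak form in terms of the generator -/

section Generator

variable {d : ℕ}

/-- Jointly continuous and bounded coefficients. -/
structure IsBoundedContinuousCoeff (b : ℝ≥0 → Rd d → Rd d) (w : ℝ≥0 → Rd d → ℝ) (C : ℝ) :
    Prop where
  continuous_drift : Continuous fun p : ℝ≥0 × Rd d => b p.1 p.2
  continuous_rate : Continuous fun p : ℝ≥0 × Rd d => w p.1 p.2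
  norm_drift_le : ∀ t x, ‖b t x‖ ≤ C
  abs_rate_le : ∀ t x, |w t x| ≤ C

/-- The function `∂ₜΨ + b · ∇ₓΨ + w Ψ`. -/
noncomputable def generator (b : ℝ≥0 → Rd d → Rd d) (w : ℝ≥0 → Rd d → ℝ) (Ψ : ℝ × Rd d → ℝ)
    (t : ℝ≥0) (x : Rd d) : ℝ :=
  fderiv ℝ Ψ (t, x) (1, 0) + fderiv ℝ Ψ (t, x) (0, b t x) + w t x * Ψ (t, x)

variable {b : ℝ≥0 → Rd d → Rd d} {w : ℝ≥0 → Rd d → ℝ} {C : ℝ} {ν : ℝ≥0 → M d} {μ₀ : M d}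

theorem continuous_fderiv_time {Ψ : ℝ × Rd d → ℝ} (hΨ : ContDiff ℝ 1 Ψ) :
    Continuous fun p : ℝ≥0 × Rd d => fderiv ℝ Ψ ((p.1 : ℝ), p.2) (1, 0) := by
  have h : Continuous fun p : ℝ≥0 × Rd d => ((p.1 : ℝ), p.2) := by fun_prop
  exact ((hΨ.continuous_fderiv one_ne_zero).comp h).clm_apply continuous_const

theorem continuous_fderiv_drift (hb : Continuous fun p : ℝ≥0 × Rd d => b p.1 p.2)
    {Ψ : ℝ × Rd d → ℝ} (hΨ : ContDiff ℝ 1 Ψ) :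
    Continuous fun p : ℝ≥0 × Rd d => fderiv ℝ Ψ ((p.1 : ℝ), p.2) (0, b p.1 p.2) := by
  have h : Continuous fun p : ℝ≥0 × Rd d => ((p.1 : ℝ), p.2) := by fun_prop
  exact ((hΨ.continuous_fderiv one_ne_zero).comp h).clm_apply (continuous_const.prodMk hb)

theorem continuous_rate_mul (hw : Continuous fun p : ℝ≥0 × Rd d => w p.1 p.2)
    {Ψ : ℝ × Rd d → ℝ} (hΨ : ContDiff ℝ 1 Ψ) :
    Continuous fun p : ℝ≥0 × Rd d => w p.1 p.2 * Ψ ((p.1 : ℝ), p.2) := by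
  have h : Continuous fun p : ℝ≥0 × Rd d => ((p.1 : ℝ), p.2) := by fun_prop
  exact hw.mul (hΨ.continuous.comp h)

theorem IsBoundedContinuousCoeff.continuous_generator (hbw : IsBoundedContinuousCoeff b w C)
    {Ψ : ℝ × Rd d → ℝ} (hΨ : ContDiff ℝ 1 Ψ) :
    Continuous fun p : ℝ≥0 × Rd d => generator b w Ψ p.1 p.2 :=
  ((continuous_fderiv_time hΨ).add (continuous_fderiv_drift hbw.continuous_drift hΨ)).add
    (continuous_rate_mul hbw.continuous_rate hΨ)

/-- A function on space-time whose support is contained in a strip `ℝ × K`. -/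
def IsSpatiallySupportedIn (K : Set (Rd d)) (Ψ : ℝ × Rd d → ℝ) : Prop :=
  tsupport Ψ ⊆ {p | p.2 ∈ K}

theorem IsSpatiallySupportedIn.of_forall {K : Set (Rd d)} (hK : IsClosed K) {Ψ : ℝ × Rd d → ℝ}
    (h : ∀ t, ∀ x ∉ K, Ψ (t, x) = 0) : IsSpatiallySupportedIn K Ψ :=
  closure_minimal (fun p hp => by_contra fun hpK => hp (h p.1 p.2 hpK))
    (hK.preimage continuous_snd)

theorem IsSpatiallySupportedIn.apply_eq_zero {K : Set (Rd d)} {Ψ : ℝ × Rd d → ℝ}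
    (h : IsSpatiallySupportedIn K Ψ) (t : ℝ) {x : Rd d} (hx : x ∉ K) : Ψ (t, x) = 0 :=
  image_eq_zero_of_notMem_tsupport fun hp => hx (h hp)

theorem IsSpatiallySupportedIn.fderiv_eq_zero {K : Set (Rd d)} {Ψ : ℝ × Rd d → ℝ}
    (h : IsSpatiallySupportedIn K Ψ) (t : ℝ) {x : Rd d} (hx : x ∉ K) :
    fderiv ℝ Ψ (t, x) = 0 :=
  fderiv_of_notMem_tsupport ℝ fun hp => hx (h hp)

theorem IsSpatiallySupportedIn.generator_eq_zero {K : Set (Rd d)} {Ψ : ℝ × Rd d → ℝ}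
    (h : IsSpatiallySupportedIn K Ψ) (t : ℝ≥0) {x : Rd d} (hx : x ∉ K) :
    generator b w Ψ t x = 0 := by
  simp [generator, h.fderiv_eq_zero t hx, h.apply_eq_zero t hx]

theorem continuous_integral_generator (hν : IsNarrowlyContinuous ν)
    (hbw : IsBoundedContinuousCoeff b w C) {Ψ : ℝ × Rd d → ℝ} (hΨ : ContDiff ℝ 1 Ψ)
    {K : Set (Rd d)} (hK : IsCompact K) (hΨK : IsSpatiallySupportedIn K Ψ) :
    Continuous fun t => ∫ᵛ x, generator b w Ψ t x ∂•(ν t) :=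
  hν.continuous_integral (hbw.continuous_generator hΨ) hK fun t _ hx => hΨK.generator_eq_zero t hx

theorem continuous_integral_test (hν : IsNarrowlyContinuous ν)
    {Ψ : ℝ × Rd d → ℝ} (hΨ : Continuous Ψ)
    {K : Set (Rd d)} (hK : IsCompact K) (hΨK : IsSpatiallySupportedIn K Ψ) :
    Continuous fun t : ℝ≥0 => ∫ᵛ x, Ψ (t, x) ∂•(ν t) :=
  hν.continuous_integral (g := fun t x => Ψ (t, x))
    (hΨ.comp (by fun_prop : Continuous fun p : ℝ≥0 × Rd d => ((p.1 : ℝ), p.2))) hK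
    fun t _ hx => hΨK.apply_eq_zero t hx

theorem exists_bounds_of_isCompact {S : Set (ℝ × Rd d)} (hS : IsCompact S) :
    ∃ (T : ℝ≥0) (K : Set (Rd d)), IsCompact K ∧ ∀ p ∈ S, p.1 ≤ T ∧ p.2 ∈ K := by
  obtain ⟨T, hT⟩ := (hS.image continuous_fst).bddAbove
  exact ⟨T.toNNReal, Prod.snd '' S, hS.image continuous_snd, fun p hp =>
    ⟨(hT ⟨p, hp, rfl⟩).trans (Real.le_coe_toNNReal T), ⟨p, hp, rfl⟩⟩⟩

theorem integral_Ioi_eq_intervalIntegral {F : ℝ≥0 → ℝ} {T : ℝ≥0} (hF : ∀ t, T < t → F t = 0) :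
    ∫ t in Ioi (0 : ℝ), F t.toNNReal = ∫ t in (0 : ℝ)..T, F t.toNNReal := by
  rw [intervalIntegral.integral_of_le (NNReal.coe_nonneg T)]
  refine setIntegral_eq_of_subset_of_forall_sdiff_eq_zero measurableSet_Ioi Ioc_subset_Ioi_self ?_
  rintro t ⟨ht, ht'⟩
  refine hF _ ?_
  rw [Real.lt_toNNReal_iff_coe_lt]
  by_contra h
  exact ht' ⟨ht, not_lt.1 h⟩

theorem integrableOn_Ioi_toNNReal {F : ℝ≥0 → ℝ} (hc : Continuous F) {T : ℝ≥0}
    (hF : ∀ t, T < t → F t = 0) : IntegrableOn (fun t : ℝ => F t.toNNReal) (Ioi 0) := by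
  have hc' : Continuous fun t : ℝ => F t.toNNReal := hc.comp continuous_real_toNNReal
  have h1 : IntegrableOn (fun t : ℝ => F t.toNNReal) (Ioc 0 T) :=
    (hc'.integrableOn_Icc).mono_set Ioc_subset_Icc_self
  refine h1.of_forall_sdiff_eq_zero measurableSet_Ioi ?_
  rintro t ⟨ht, ht'⟩
  refine hF _ ?_
  rw [Real.lt_toNNReal_iff_coe_lt]
  by_contra h
  exact ht' ⟨ht, not_lt.1 h⟩

/-- Merging the transport and reaction integrals requires integrability in time: each spatial
integral is continuous in `t` and vanishes beyond the support of `φ`. -/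
theorem satisfiesWeakForm_iff (hν : IsNarrowlyContinuous ν)
    (hbw : IsBoundedContinuousCoeff b w C) {n : WithTop ℕ∞} (hn : 1 ≤ n) :
    SatisfiesWeakForm n b w μ₀ ν ↔
      ∀ φ : ℝ × Rd d → ℝ, ContDiff ℝ n φ → HasCompactSupport φ →
        (∫ t in Ioi (0 : ℝ), ∫ᵛ x, generator b w φ t.toNNReal x ∂•(ν t.toNNReal))
          + ∫ᵛ x, φ (0, x) ∂•μ₀ = 0 := by
  refine forall_congr' fun φ => forall_congr' fun hφ => forall_congr' fun hc => ?_
  have hφ1 := hφ.of_le hn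
  obtain ⟨T, K, hK, hTK⟩ := exists_bounds_of_isCompact hc
  have hKφ : IsSpatiallySupportedIn K φ := fun p hp => (hTK p hp).2
  have hT : ∀ (t : ℝ≥0) x, T < t → ((t : ℝ), x) ∉ tsupport φ := fun t x ht hp =>
    absurd (hTK _ hp).1 (not_le.2 (NNReal.coe_lt_coe.2 ht))
  let A : ℝ≥0 → Rd d → ℝ := fun t x =>
    fderiv ℝ φ (t, x) (1, 0) + fderiv ℝ φ (t, x) (0, b t x)
  let R : ℝ≥0 → Rd d → ℝ := fun t x => w t x * φ (t, x)
  have hA : Continuous fun p : ℝ≥0 × Rd d => A p.1 p.2 :=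
    (continuous_fderiv_time hφ1).add (continuous_fderiv_drift hbw.continuous_drift hφ1)
  have hR : Continuous fun p : ℝ≥0 × Rd d => R p.1 p.2 := continuous_rate_mul hbw.continuous_rate hφ1
  have hAK : ∀ t, ∀ x ∉ K, A t x = 0 := fun t x hx => by
    simp [A, hKφ.fderiv_eq_zero t hx]
  have hRK : ∀ t, ∀ x ∉ K, R t x = 0 := fun t x hx => by
    simp [R, hKφ.apply_eq_zero t hx]
  have hAT : ∀ t, T < t → ∫ᵛ x, A t x ∂•(ν t) = 0 := fun t ht => by
    simp [A, fderiv_of_notMem_tsupport ℝ (hT t _ ht)]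
  have hRT : ∀ t, T < t → ∫ᵛ x, R t x ∂•(ν t) = 0 := fun t ht => by
    simp [R, image_eq_zero_of_notMem_tsupport (hT t _ ht)]
  have hsum : ∀ t, ∫ᵛ x, generator b w φ t x ∂•(ν t) =
      (∫ᵛ x, A t x ∂•(ν t)) + ∫ᵛ x, R t x ∂•(ν t) := fun t =>
    VectorMeasure.integral_fun_add
      (integrable_of_hasCompactSupport _ (hA.comp (by fun_prop : Continuous fun x => (t, x)))
        (HasCompactSupport.intro hK (hAK t)))
      (integrable_of_hasCompactSupport _ (hR.comp (by fun_prop : Continuous fun x => (t, x)))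
        (HasCompactSupport.intro hK (hRK t)))
  simp only [hsum]
  rw [integral_add (integrableOn_Ioi_toNNReal (hν.continuous_integral hA hK hAK) hAT)
    (integrableOn_Ioi_toNNReal (hν.continuous_integral hR hK hRK) hRT)]
  have e1 : ∫ t in Ioi (0 : ℝ), ∫ᵛ x,
        (fderiv ℝ φ (t, x) (1, 0) + fderiv ℝ φ (t, x) (0, b t.toNNReal x)) ∂•(ν t.toNNReal) =
      ∫ t in Ioi (0 : ℝ), ∫ᵛ x, A t.toNNReal x ∂•(ν t.toNNReal) :=
    setIntegral_congr_fun measurableSet_Ioi fun t ht => by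
      simp only [A, Real.coe_toNNReal t (le_of_lt ht)]
  have e2 : ∫ t in Ioi (0 : ℝ), ∫ᵛ x, (w t.toNNReal x * φ (t, x)) ∂•(ν t.toNNReal) =
      ∫ t in Ioi (0 : ℝ), ∫ᵛ x, R t.toNNReal x ∂•(ν t.toNNReal) :=
    setIntegral_congr_fun measurableSet_Ioi fun t ht => by
      simp only [R, Real.coe_toNNReal t (le_of_lt ht)]
  rw [e1, e2]
  constructor <;> intro h <;> linarith

theorem norm_prod_zero_left (u : Rd d) : ‖((0 : ℝ), u)‖ = ‖u‖ := by
  simp [Prod.norm_def]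

theorem norm_prod_one_zero : ‖((1 : ℝ), (0 : Rd d))‖ = 1 := by
  simp [Prod.norm_def]

theorem IsBoundedContinuousCoeff.abs_generator_sub_le (hbw : IsBoundedContinuousCoeff b w C)
    {φ g : ℝ × Rd d → ℝ} {ε : ℝ} (h0 : ∀ p, |g p - φ p| ≤ ε)
    (h1 : ∀ p, ‖fderiv ℝ g p - fderiv ℝ φ p‖ ≤ ε) (t : ℝ≥0) (x : Rd d) :
    |generator b w g t x - generator b w φ t x| ≤ ε * (1 + 2 * C) := by
  have hε : 0 ≤ ε := (abs_nonneg _).trans (h0 0)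
  have hC : 0 ≤ C := (norm_nonneg _).trans (hbw.norm_drift_le 0 0)
  have e : generator b w g t x - generator b w φ t x =
      (fderiv ℝ g (t, x) - fderiv ℝ φ (t, x)) (1, 0) +
      (fderiv ℝ g (t, x) - fderiv ℝ φ (t, x)) (0, b t x) + w t x * (g (t, x) - φ (t, x)) := by
    simp only [generator, _root_.sub_apply]
    ring
  have a1 : |(fderiv ℝ g (t, x) - fderiv ℝ φ (t, x)) (1, 0)| ≤ ε * 1 := by
    have := (fderiv ℝ g (t, x) - fderiv ℝ φ (t, x)).le_of_opNorm_le (h1 (t, x)) (1, 0)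
    rwa [norm_prod_one_zero] at this
  have a2 : |(fderiv ℝ g (t, x) - fderiv ℝ φ (t, x)) (0, b t x)| ≤ ε * C := by
    have := (fderiv ℝ g (t, x) - fderiv ℝ φ (t, x)).le_of_opNorm_le (h1 (t, x)) (0, b t x)
    rw [norm_prod_zero_left] at this
    exact this.trans (by gcongr; exact hbw.norm_drift_le t x)
  have a3 : |w t x * (g (t, x) - φ (t, x))| ≤ C * ε := by
    rw [abs_mul]
    exact mul_le_mul (hbw.abs_rate_le t x) (h0 _) (abs_nonneg _) hC
  rw [e]
  refine (abs_add_three _ _ _).trans ?_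
  linarith

/-- The weak form involves only first derivatives, so mollifying `φ` perturbs the generator
uniformly. All the approximants live in one compact set, on whose time range the masses are bounded.
-/
theorem SatisfiesWeakForm.of_smooth (hν : IsNarrowlyContinuous ν)
    (hbw : IsBoundedContinuousCoeff b w C) (h : SatisfiesWeakForm ∞ b w μ₀ ν) :
    SatisfiesWeakForm 1 b w μ₀ ν := by
  rw [satisfiesWeakForm_iff hν hbw le_rfl]
  rw [satisfiesWeakForm_iff hν hbw (by norm_cast)] at h
  intro φ hφ hc
  have hc1 : IsCompact (Metric.cthickening 1 (tsupport φ)) := hc.isCompact.cthickening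
  obtain ⟨T, K, hK, hTK⟩ := exists_bounds_of_isCompact hc1
  obtain ⟨V, hV⟩ := hν.exists_totalMass_le T
  have hC : 0 ≤ C := (norm_nonneg _).trans (hbw.norm_drift_le 0 0)
  have hV0 : 0 ≤ V := (totalMass_nonneg _).trans (hV 0 zero_le)
  have hsub : tsupport φ ⊆ Metric.cthickening 1 (tsupport φ) := Metric.self_subset_cthickening _
  have hK' : ∀ g : ℝ × Rd d → ℝ, tsupport g ⊆ Metric.cthickening 1 (tsupport φ) →
      IsSpatiallySupportedIn K g := fun g hg p hp => (hTK p (hg hp)).2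
  have hT : ∀ g : ℝ × Rd d → ℝ, tsupport g ⊆ Metric.cthickening 1 (tsupport φ) →
      ∀ t, T < t → ∫ᵛ x, generator b w g t x ∂•(ν t) = 0 := fun g hg t ht => by
    have : ∀ x, ((t : ℝ), x) ∉ tsupport g := fun x hp =>
      absurd (hTK _ (hg hp)).1 (not_le.2 (NNReal.coe_lt_coe.2 ht))
    simp [generator, fderiv_of_notMem_tsupport ℝ (this _), image_eq_zero_of_notMem_tsupport (this _)]
  have hφc := continuous_integral_generator hν hbw hφ hK (hK' φ hsub)
  -- An approximation error `ε'` costs at most `ε' * D` in the weak form. Dividing by `D + 1` below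
  -- covers the case `D = 0`.
  set D : ℝ := (1 + 2 * C) * V * T + totalMass μ₀ with hD
  have hD0 : 0 ≤ D := by have := totalMass_nonneg μ₀; positivity
  refine abs_nonpos_iff.1 (le_of_forall_pos_le_add fun ε hε => ?_)
  obtain ⟨g, hg, hgs, hg0, hg1⟩ := exists_contDiff_infty_approx hφ hc
    (ε := ε / (D + 1)) (by positivity)
  have hg' : ContDiff ℝ 1 g := hg.of_le (by norm_cast)
  have hgc : HasCompactSupport g := hc1.of_isClosed_subset (isClosed_tsupport g) hgs
  have hgcont := continuous_integral_generator hν hbw hg' hK (hK' g hgs)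
  have e := h g hg hgc
  rw [integral_Ioi_eq_intervalIntegral (hT g hgs)] at e
  rw [integral_Ioi_eq_intervalIntegral (hT φ hsub), ← abs_neg, zero_add]
  have i1 : ∫ t in (0 : ℝ)..T, ((∫ᵛ x, generator b w g t.toNNReal x ∂•(ν t.toNNReal)) -
      ∫ᵛ x, generator b w φ t.toNNReal x ∂•(ν t.toNNReal)) =
      (∫ t in (0 : ℝ)..T, ∫ᵛ x, generator b w g t.toNNReal x ∂•(ν t.toNNReal)) -
      ∫ t in (0 : ℝ)..T, ∫ᵛ x, generator b w φ t.toNNReal x ∂•(ν t.toNNReal) :=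
    intervalIntegral.integral_sub
      ((hgcont.comp continuous_real_toNNReal).intervalIntegrable _ _)
      ((hφc.comp continuous_real_toNNReal).intervalIntegrable _ _)
  have hgen : ∀ (f : ℝ × Rd d → ℝ), ContDiff ℝ 1 f → IsSpatiallySupportedIn K f → ∀ t,
      (ν t).Integrable (generator b w f t) := fun f hf hfK t =>
    integrable_of_hasCompactSupport _
      ((hbw.continuous_generator hf).comp (by fun_prop : Continuous fun x => (t, x)))
      (HasCompactSupport.intro hK fun x hx => hfK.generator_eq_zero t hx)
  have b1 : |∫ t in (0 : ℝ)..T, ((∫ᵛ x, generator b w g t.toNNReal x ∂•(ν t.toNNReal)) -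
      ∫ᵛ x, generator b w φ t.toNNReal x ∂•(ν t.toNNReal))| ≤
      ε / (D + 1) * (1 + 2 * C) * V * |(T : ℝ) - 0| := by
    rw [← Real.norm_eq_abs]
    refine intervalIntegral.norm_integral_le_of_norm_le_const fun t ht => ?_
    rw [uIoc_of_le (NNReal.coe_nonneg T)] at ht
    rw [← VectorMeasure.integral_fun_sub (hgen g hg' (hK' g hgs) _) (hgen φ hφ (hK' φ hsub) _)]
    refine (abs_integral_le _ (hbw.abs_generator_sub_le hg0 hg1 _)).trans ?_
    gcongr
    exact hV _ (Real.toNNReal_le_iff_le_coe.2 ht.2)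
  have hzero : ∀ f : ℝ × Rd d → ℝ, ContDiff ℝ 1 f → IsSpatiallySupportedIn K f →
      μ₀.Integrable fun x => f (0, x) := fun f hf hfK =>
    integrable_of_hasCompactSupport _
      (hf.continuous.comp (by fun_prop : Continuous fun x : Rd d => ((0 : ℝ), x)))
      (HasCompactSupport.intro hK fun x hx => hfK.apply_eq_zero 0 hx)
  have b2 : |∫ᵛ x, (g (0, x) - φ (0, x)) ∂•μ₀| ≤ ε / (D + 1) * totalMass μ₀ :=
    abs_integral_le _ fun x => hg0 _
  rw [VectorMeasure.integral_fun_sub (hzero g hg' (hK' g hgs)) (hzero φ hφ (hK' φ hsub))] at b2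
  rw [i1] at b1
  rw [sub_zero, abs_of_nonneg (NNReal.coe_nonneg T)] at b1
  have hfin : ε / (D + 1) * D ≤ ε := by
    rw [div_mul_eq_mul_div, div_le_iff₀ (by positivity)]
    nlinarith
  have hexp : ε / (D + 1) * (1 + 2 * C) * V * T + ε / (D + 1) * totalMass μ₀ =
      ε / (D + 1) * D := by rw [hD]; ring
  rw [abs_le] at b1 b2 ⊢
  constructor <;> linarith [b1.1, b1.2, b2.1, b2.2]

end Generator

/-! ### From the weak form to an identity at each time -/

section Evolution

/-- A primitive of an odd function is even, so normalizing it to vanish beyond `T` also makes it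
vanish before `-T`. This gives a compactly supported time factor on the whole line. -/
theorem exists_primitive_of_odd {g : ℝ → ℝ} (hg : Continuous g) (hodd : ∀ r, g (-r) = -g r)
    {T : ℝ} (hT : ∀ r, T ≤ r → g r = 0) :
    ∃ θ : ℝ → ℝ, ContDiff ℝ 1 θ ∧ (∀ r, HasDerivAt θ (g r) r) ∧ ∀ r, T ≤ |r| → θ r = 0 := by
  let θ : ℝ → ℝ := fun r => (∫ s in (0 : ℝ)..r, g s) - ∫ s in (0 : ℝ)..T, g s
  have hd : ∀ r, HasDerivAt θ (g r) r := fun r =>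
     (hg.integral_hasStrictDerivAt 0 r).hasDerivAt.sub_const (∫ s in (0 : ℝ)..T, g s)
  have heven : ∀ r, θ (-r) = θ r := fun r => by
    have : ∫ s in (0 : ℝ)..(-r), g s = ∫ s in (0 : ℝ)..r, g s := by
      have h1 := intervalIntegral.integral_comp_neg (a := (0 : ℝ)) (b := r) g
      simp only [hodd, neg_zero, intervalIntegral.integral_neg] at h1
      rw [intervalIntegral.integral_symm, ← h1, neg_neg]
    simp only [θ, this]
  have hz : ∀ r, T ≤ r → θ r = 0 := fun r hr => by
    have h1 : ∫ s in T..r, g s = 0 := by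
      rw [intervalIntegral.integral_congr (g := fun _ => 0)]
      · simp
      · intro s hs
        rw [uIcc_of_le hr] at hs
        exact hT s hs.1
    have h2 := intervalIntegral.integral_add_adjacent_intervals
      (hg.intervalIntegrable (μ := volume) 0 T) (hg.intervalIntegrable T r)
    simp only [θ]
    rw [← h2, h1]
    ring
  refine ⟨θ, ?_, hd, fun r hr => ?_⟩
  · rw [contDiff_one_iff_deriv]
    refine ⟨fun r => (hd r).differentiableAt, ?_⟩
    rwa [show deriv θ = g from funext fun r => (hd r).deriv]
  · rcases abs_choice r with h | h
    · exact hz r (h ▸ hr)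
    · rw [← heven]
      exact hz _ (h ▸ hr)

/-- The du Bois-Reymond lemma. Put `H = F - c - P` with `P` the primitive of `G`; integration by
parts reduces the hypothesis to `∫ θ' H = 0`, and `θ'` is chosen as `H` times a nonnegative weight.
-/
theorem eq_add_integral_of_forall_test {F G : ℝ → ℝ} (hF : Continuous F) (hG : Continuous G)
    {c : ℝ} (h : ∀ (θ : ℝ → ℝ) (T : ℝ), ContDiff ℝ 1 θ → 0 < T → (∀ r, T ≤ |r| → θ r = 0) →
      (∫ r in (0 : ℝ)..T, (deriv θ r * F r + θ r * G r)) + θ 0 * c = 0) {t : ℝ} (ht : 0 ≤ t) :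
    F t = c + ∫ r in (0 : ℝ)..t, G r := by
  let P : ℝ → ℝ := fun t => ∫ r in (0 : ℝ)..t, G r
  have hP : ∀ r, HasDerivAt P (G r) r := fun r => (hG.integral_hasStrictDerivAt 0 r).hasDerivAt
  have hPc : Continuous P := continuous_iff_continuousAt.2 fun r => (hP r).continuousAt
  let H : ℝ → ℝ := fun t => F t - c - P t
  have hH : Continuous H := (hF.sub continuous_const).sub hPc
  -- The weight used below vanishes at 0, so that endpoint is recovered by continuity.
  suffices hpos : ∀ t, 0 < t → H t = 0 by
    have h0 : H t = 0 := by
      rcases ht.eq_or_lt with rfl | ht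
      · have h1 : Tendsto H (𝓝[>] 0) (𝓝 (H 0)) := (hH.tendsto 0).mono_left nhdsWithin_le_nhds
        have h2 : Tendsto H (𝓝[>] 0) (𝓝 0) :=
          tendsto_const_nhds.congr' (eventually_nhdsWithin_of_forall fun s hs => (hpos s hs).symm)
        exact tendsto_nhds_unique h1 h2
      · exact hpos t ht
    simp only [H, P] at h0
    linarith
  intro t ht
  let T : ℝ := t + 1
  have hT : 0 < T := by positivity
  -- On `[0, T]` this is `r (T - r) H`, so `g * H ≥ 0`. The absolute values make it odd, and `T = t
  -- + 1` makes the weight positive at `t`.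
  let g : ℝ → ℝ := fun r => r * max 0 (T - |r|) * H |r|
  have hg : Continuous g := by fun_prop
  obtain ⟨θ, hθ, hd, hz⟩ := exists_primitive_of_odd hg (T := T)
    (fun r => by simp [g]) fun r hr => by
      have : T - |r| ≤ 0 := by linarith [le_abs_self r]
      simp [g, max_eq_left this]
  have key := h θ T hθ hT hz
  have hθT : θ T = 0 := hz T (le_abs_self T)
  have hθc : Continuous θ := hθ.continuous
  have ibp : ∫ r in (0 : ℝ)..T, (g r * P r + θ r * G r) = 0 := by
    have := intervalIntegral.integral_eq_sub_of_hasDerivAt (a := 0) (b := T)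
      (f := fun r => θ r * P r) (f' := fun r => g r * P r + θ r * G r)
      (fun r _ => (hd r).mul (hP r)) (by apply Continuous.intervalIntegrable; fun_prop)
    rw [this]
    simp [hθT, P]
  have ig : ∫ r in (0 : ℝ)..T, g r = - θ 0 := by
    rw [intervalIntegral.integral_eq_sub_of_hasDerivAt (f := θ) (fun r _ => hd r)
      (hg.intervalIntegrable _ _), hθT, zero_sub]
  have hzero : ∫ r in (0 : ℝ)..T, g r * H r = 0 := by
    have e : ∀ r, g r * H r = (deriv θ r * F r + θ r * G r) - (g r * P r + θ r * G r) - g r * c := by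
      intro r
      rw [(hd r).deriv]
      simp only [H]
      ring
    simp only [e]
    have hdc : Continuous (deriv θ) := by
      rwa [show deriv θ = g from funext fun r => (hd r).deriv]
    rw [intervalIntegral.integral_sub, intervalIntegral.integral_sub, ibp,
      intervalIntegral.integral_mul_const, ig]
    · linarith
    all_goals apply Continuous.intervalIntegrable; fun_prop
  by_contra hne
  have : 0 < ∫ r in (0 : ℝ)..T, g r * H r := by
    have hgH : ∀ r, 0 ≤ r → g r * H r = r * max 0 (T - |r|) * H r ^ 2 := fun r hr => by
      simp only [g, abs_of_nonneg hr]
      ring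
    refine intervalIntegral.integral_pos hT (hg.mul hH).continuousOn (fun r hr => ?_)
      ⟨t, ⟨ht.le, by simp [T]⟩, ?_⟩
    · rw [hgH r hr.1.le]
      have := hr.1.le
      positivity
    · rw [hgH t ht.le, abs_of_nonneg ht.le]
      have : T - t = 1 := by simp [T]
      rw [this]
      positivity
  exact this.ne' hzero

variable {d : ℕ}

/-- Integrated form of the weak formulation, for test functions that are of class `C^1` and
compactly supported in space. -/
def HasEvolution (b : ℝ≥0 → Rd d → Rd d) (w : ℝ≥0 → Rd d → ℝ) (μ₀ : M d) (ν : ℝ≥0 → M d) : Prop :=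
  ∀ (Ψ : ℝ × Rd d → ℝ) (K : Set (Rd d)), ContDiff ℝ 1 Ψ → IsCompact K →
    IsSpatiallySupportedIn K Ψ → ∀ t : ℝ≥0,
      ∫ᵛ x, Ψ (t, x) ∂•(ν t) = ∫ᵛ x, Ψ (0, x) ∂•μ₀ +
        ∫ r in (0 : ℝ)..t, ∫ᵛ x, generator b w Ψ r.toNNReal x ∂•(ν r.toNNReal)

variable {b : ℝ≥0 → Rd d → Rd d} {w : ℝ≥0 → Rd d → ℝ} {C : ℝ} {ν ν' : ℝ≥0 → M d} {μ₀ μ₀' : M d}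

theorem generator_time_mul {Ψ : ℝ × Rd d → ℝ} (hΨ : ContDiff ℝ 1 Ψ) {θ : ℝ → ℝ}
    (hθ : ContDiff ℝ 1 θ) (t : ℝ≥0) (x : Rd d) :
    generator b w (fun p => θ p.1 * Ψ p) t x =
      deriv θ t * Ψ (t, x) + θ t * generator b w Ψ t x := by
  have h1 : HasFDerivAt (fun p : ℝ × Rd d => θ p.1)
      ((ContinuousLinearMap.toSpanSingleton ℝ (deriv θ t)).comp
        (ContinuousLinearMap.fst ℝ ℝ (Rd d))) ((t : ℝ), x) :=
    ((hθ.differentiable one_ne_zero t).hasDerivAt.hasFDerivAt).comp ((t : ℝ), x) hasFDerivAt_fst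
  have h2 : HasFDerivAt (fun p : ℝ × Rd d => θ p.1 * Ψ p) _ ((t : ℝ), x) :=
    h1.mul (hΨ.differentiable one_ne_zero ((t : ℝ), x)).hasFDerivAt
  simp only [generator]
  rw [h2.fderiv]
  simp
  ring

/-- Testing with `θ(t) Ψ(t, x)` reduces the claim to the scalar lemma above; `θ` supplies the
compact support in time that `Ψ` may lack. -/
theorem SatisfiesWeakForm.hasEvolution (hν : IsNarrowlyContinuous ν)
    (hbw : IsBoundedContinuousCoeff b w C) (h : SatisfiesWeakForm 1 b w μ₀ ν) :
    HasEvolution b w μ₀ ν := by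
  rw [satisfiesWeakForm_iff hν hbw le_rfl] at h
  intro Ψ K hΨ hK hΨK t
  have hF := continuous_integral_test hν hΨ.continuous hK hΨK
  have hG := continuous_integral_generator hν hbw hΨ hK hΨK
  have main := eq_add_integral_of_forall_test (F := fun r => ∫ᵛ x, Ψ (r.toNNReal, x) ∂•(ν r.toNNReal))
    (G := fun r => ∫ᵛ x, generator b w Ψ r.toNNReal x ∂•(ν r.toNNReal))
    (c := ∫ᵛ x, Ψ (0, x) ∂•μ₀)
    (hF.comp continuous_real_toNNReal) (hG.comp continuous_real_toNNReal) ?_ (NNReal.coe_nonneg t)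
  · simpa only [Real.toNNReal_coe] using main
  intro θ T hθ hT hz
  have hφ : ContDiff ℝ 1 fun p : ℝ × Rd d => θ p.1 * Ψ p := (hθ.comp contDiff_fst).mul hΨ
  have hc : HasCompactSupport fun p : ℝ × Rd d => θ p.1 * Ψ p := by
    refine HasCompactSupport.intro ((isCompact_Icc (a := -T) (b := T)).prod hK) fun p hp => ?_
    by_cases hx : p.2 ∈ K
    · have : T ≤ |p.1| := by
        by_contra hlt
        exact hp ⟨abs_le.1 (not_le.1 hlt).le, hx⟩
      rw [hz _ this, zero_mul]
    · rw [show Ψ p = 0 from hΨK.apply_eq_zero p.1 hx, mul_zero]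
  have e := h _ hφ hc
  simp only [generator_time_mul hΨ hθ] at e
  have hint : ∀ s, (ν s).Integrable fun x => Ψ (s, x) := fun s =>
    integrable_of_hasCompactSupport _ (hΨ.continuous.comp (by fun_prop))
      (HasCompactSupport.intro hK fun x hx => hΨK.apply_eq_zero _ hx)
  have hint' : ∀ s, (ν s).Integrable (generator b w Ψ s) := fun s =>
    integrable_of_hasCompactSupport _
      ((hbw.continuous_generator hΨ).comp (by fun_prop : Continuous fun x => (s, x)))
      (HasCompactSupport.intro hK fun x hx => hΨK.generator_eq_zero s hx)
  have hsplit : ∀ s : ℝ≥0, ∫ᵛ x, (deriv θ s * Ψ (s, x) + θ s * generator b w Ψ s x) ∂•(ν s) =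
      deriv θ s * ∫ᵛ x, Ψ (s, x) ∂•(ν s) + θ s * ∫ᵛ x, generator b w Ψ s x ∂•(ν s) := fun s => by
    have h1 := VectorMeasure.integral_fun_smul (ν s) (ContinuousLinearMap.lsmul ℝ ℝ) (deriv θ s)
      fun x => Ψ (s, x)
    have h2 := VectorMeasure.integral_fun_smul (ν s) (ContinuousLinearMap.lsmul ℝ ℝ) (θ s)
      (generator b w Ψ s)
    simp only [smul_eq_mul] at h1 h2
    rw [← h1, ← h2]
    exact VectorMeasure.integral_fun_add ((hint s).const_mul _) ((hint' s).const_mul _)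
  have hθ0 : ∫ᵛ x, θ 0 * Ψ (0, x) ∂•μ₀ = θ 0 * ∫ᵛ x, Ψ (0, x) ∂•μ₀ :=
    VectorMeasure.integral_fun_smul μ₀ (ContinuousLinearMap.lsmul ℝ ℝ) (θ 0) fun x => Ψ (0, x)
  simp only [hsplit, hθ0] at e
  rw [integral_Ioi_eq_intervalIntegral (F := fun s => deriv θ s * ∫ᵛ x, Ψ (s, x) ∂•(ν s) +
    θ s * ∫ᵛ x, generator b w Ψ s x ∂•(ν s)) (T := ⟨T, hT.le⟩)] at e
  · refine Eq.trans ?_ e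
    congr 1
    refine intervalIntegral.integral_congr fun r hr => ?_
    change r ∈ uIcc 0 T at hr
    rw [uIcc_of_le hT.le] at hr
    simp only [Real.coe_toNNReal r hr.1]
  · intro s hs
    have hs' : T < s := hs
    have hd : deriv θ s = 0 := by
      have : θ =ᶠ[𝓝 (s : ℝ)] fun _ => 0 := by
        filter_upwards [lt_mem_nhds hs'] with r hr
        exact hz r (hr.le.trans (le_abs_self r))
      rw [this.deriv_eq, deriv_const]
    rw [hd, hz s (hs'.le.trans (le_abs_self _))]
    ring

theorem HasEvolution.sub (hν : IsNarrowlyContinuous ν) (hν' : IsNarrowlyContinuous ν')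
    (hbw : IsBoundedContinuousCoeff b w C) (h : HasEvolution b w μ₀ ν)
    (h' : HasEvolution b w μ₀' ν') :
    HasEvolution b w (μ₀ - μ₀') fun t => ν t - ν' t := by
  intro Ψ K hΨ hK hΨK t
  have hi : ∀ (μ : M d) (s : ℝ), μ.Integrable fun x => Ψ (s, x) := fun μ s =>
    integrable_of_hasCompactSupport _ (hΨ.continuous.comp (by fun_prop))
      (HasCompactSupport.intro hK fun x hx => hΨK.apply_eq_zero _ hx)
  have hi' : ∀ (μ : M d) (s : ℝ≥0), μ.Integrable (generator b w Ψ s) := fun μ s =>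
    integrable_of_hasCompactSupport _
      ((hbw.continuous_generator hΨ).comp (by fun_prop : Continuous fun x => (s, x)))
      (HasCompactSupport.intro hK fun x hx => hΨK.generator_eq_zero s hx)
  have hG := (continuous_integral_generator hν hbw hΨ hK hΨK).comp continuous_real_toNNReal
  have hG' := (continuous_integral_generator hν' hbw hΨ hK hΨK).comp continuous_real_toNNReal
  have e : ∀ s : ℝ≥0, ∫ᵛ x, generator b w Ψ s x ∂•(ν s - ν' s) =
      (∫ᵛ x, generator b w Ψ s x ∂•(ν s)) - ∫ᵛ x, generator b w Ψ s x ∂•(ν' s) := fun s =>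
    VectorMeasure.integral_sub_vectorMeasure (hi' _ s) (hi' _ s)
  simp only [e]
  rw [VectorMeasure.integral_sub_vectorMeasure (hi _ _) (hi _ _),
    VectorMeasure.integral_sub_vectorMeasure (hi _ _) (hi _ _), h Ψ K hΨ hK hΨK t,
    h' Ψ K hΨ hK hΨK t]
  have := intervalIntegral.integral_sub (hG.intervalIntegrable (μ := volume) 0 t)
    (hG'.intervalIntegrable (μ := volume) 0 t)
  simp only [Function.comp_apply] at this
  rw [this]
  ring

/-- At time 0, with a test function constant in time, the time integral is over a degenerate
interval. -/
theorem HasEvolution.initial_eq (h : HasEvolution b w μ₀ ν) : ν 0 = μ₀ := by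
  refine eq_of_forall_integral_contDiff_eq fun ψ hψ hc => ?_
  have := h (fun p => ψ p.2) (tsupport ψ)
    ((hψ.of_le (by norm_cast)).comp contDiff_snd) hc
    (IsSpatiallySupportedIn.of_forall (isClosed_tsupport ψ) fun t x hx =>
      image_eq_zero_of_notMem_tsupport hx) 0
  simpa using this

theorem HasEvolution.sub_eq_integral (hν : IsNarrowlyContinuous ν)
    (hbw : IsBoundedContinuousCoeff b w C) (h : HasEvolution b w μ₀ ν) {Ψ : ℝ × Rd d → ℝ}
    {K : Set (Rd d)} (hΨ : ContDiff ℝ 1 Ψ) (hK : IsCompact K) (hΨK : IsSpatiallySupportedIn K Ψ)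
    (s t : ℝ≥0) :
    (∫ᵛ x, Ψ (t, x) ∂•(ν t)) - ∫ᵛ x, Ψ (s, x) ∂•(ν s) =
      ∫ r in (s : ℝ)..t, ∫ᵛ x, generator b w Ψ r.toNNReal x ∂•(ν r.toNNReal) := by
  have hG := (continuous_integral_generator hν hbw hΨ hK hΨK).comp continuous_real_toNNReal
  have := intervalIntegral.integral_interval_sub_left
    (hG.intervalIntegrable (μ := volume) 0 t) (hG.intervalIntegrable (μ := volume) 0 s)
  simp only [Function.comp_apply] at this
  rw [h Ψ K hΨ hK hΨK t, h Ψ K hΨ hK hΨK s, ← this]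
  ring

end Evolution

/-! ### Test functions without compact support in space -/

section Cutoff

variable {d : ℕ}

/-- Dilations of a single bump: the gradients decay like `1 / (n + 1)`, so the drift term on the
cutoff disappears in the limit. -/
theorem exists_cutoff_sequence (d : ℕ) : ∃ (χ : ℕ → Rd d → ℝ) (D : ℝ), 0 ≤ D ∧
    (∀ n, ContDiff ℝ 1 (χ n)) ∧ (∀ n, HasCompactSupport (χ n)) ∧ (∀ n x, |χ n x| ≤ 1) ∧
    (∀ (n : ℕ) x, ‖fderiv ℝ (χ n) x‖ ≤ D / (n + 1)) ∧
    ∀ x, Tendsto (fun n => χ n x) atTop (𝓝 1) := by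
  let f : ContDiffBump (0 : Rd d) := ⟨1, 2, one_pos, one_lt_two⟩
  have hf : ContDiff ℝ 1 f := f.contDiff
  obtain ⟨D, hD⟩ := (f.hasCompactSupport.fderiv ℝ).exists_bound_of_continuous
    (hf.continuous_fderiv one_ne_zero)
  have hpos : ∀ n : ℕ, (0 : ℝ) < (n + 1 : ℝ)⁻¹ := fun n => by positivity
  refine ⟨fun n x => f ((n + 1 : ℝ)⁻¹ • x), D, (norm_nonneg _).trans (hD 0), fun n => ?_,
    fun n => ?_, fun n x => ?_, fun n x => ?_, fun x => ?_⟩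
  · exact hf.comp (contDiff_const_smul _)
  · exact f.hasCompactSupport.comp_smul (hpos n).ne'
  · rw [abs_of_nonneg f.nonneg]
    exact f.le_one
  · have h1 : HasFDerivAt (fun y : Rd d => (n + 1 : ℝ)⁻¹ • y)
        ((n + 1 : ℝ)⁻¹ • ContinuousLinearMap.id ℝ (Rd d)) x :=
      ((n + 1 : ℝ)⁻¹ • ContinuousLinearMap.id ℝ (Rd d)).hasFDerivAt
    have h2 : HasFDerivAt (fun y : Rd d => f ((n + 1 : ℝ)⁻¹ • y)) _ x :=
      (hf.differentiable one_ne_zero ((n + 1 : ℝ)⁻¹ • x)).hasFDerivAt.comp x h1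
    rw [h2.fderiv, ContinuousLinearMap.comp_smul, norm_smul, Real.norm_of_nonneg (hpos n).le,
      ContinuousLinearMap.comp_id, div_eq_inv_mul]
    exact mul_le_mul_of_nonneg_left (hD _) (hpos n).le
  · refine tendsto_const_nhds.congr' ?_
    filter_upwards [eventually_ge_atTop ⌈‖x‖⌉₊] with n hn
    refine (f.one_of_mem_closedBall ?_).symm
    rw [mem_closedBall_zero_iff, norm_smul, Real.norm_of_nonneg (hpos n).le, inv_mul_le_iff₀
      (by positivity)]
    have := Nat.ceil_le.1 hn
    change ‖x‖ ≤ (n + 1) * 1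
    linarith

variable {b : ℝ≥0 → Rd d → Rd d} {w : ℝ≥0 → Rd d → ℝ} {C : ℝ} {ν : ℝ≥0 → M d} {μ₀ : M d}

theorem generator_space_mul {Ψ : ℝ × Rd d → ℝ} (hΨ : ContDiff ℝ 1 Ψ) {χ : Rd d → ℝ}
    (hχ : ContDiff ℝ 1 χ) (t : ℝ≥0) (x : Rd d) :
    generator b w (fun p => χ p.2 * Ψ p) t x =
      χ x * generator b w Ψ t x + fderiv ℝ χ x (b t x) * Ψ (t, x) := by
  have h1 : HasFDerivAt (fun p : ℝ × Rd d => χ p.2)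
      ((fderiv ℝ χ x).comp (ContinuousLinearMap.snd ℝ ℝ (Rd d))) ((t : ℝ), x) :=
    (hχ.differentiable one_ne_zero x).hasFDerivAt.comp ((t : ℝ), x) hasFDerivAt_snd
  have h2 : HasFDerivAt (fun p : ℝ × Rd d => χ p.2 * Ψ p) _ ((t : ℝ), x) :=
    h1.mul (hΨ.differentiable one_ne_zero ((t : ℝ), x)).hasFDerivAt
  simp only [generator]
  rw [h2.fderiv]
  simp
  ring

theorem tendsto_integral_cutoff_mul (μ : M d) {χ : ℕ → Rd d → ℝ} (hχ : ∀ n, Continuous (χ n))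
    (hχ1 : ∀ n x, |χ n x| ≤ 1) (hlim : ∀ x, Tendsto (fun n => χ n x) atTop (𝓝 1))
    {f : Rd d → ℝ} (hf : Continuous f) {A : ℝ} (hA : ∀ x, |f x| ≤ A) :
    Tendsto (fun n => ∫ᵛ x, χ n x * f x ∂•μ) atTop (𝓝 (∫ᵛ x, f x ∂•μ)) := by
  refine VectorMeasure.tendsto_integral_filter_of_norm_le_const
    (Eventually.of_forall fun n => ((hχ n).mul hf).aestronglyMeasurable)
    ⟨A, Eventually.of_forall fun n => Eventually.of_forall fun x => ?_⟩
    (Eventually.of_forall fun x => ?_)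
  · rw [norm_mul]
    calc ‖χ n x‖ * ‖f x‖ ≤ 1 * A :=
          mul_le_mul (hχ1 n x) (hA x) (norm_nonneg _) zero_le_one
      _ = A := one_mul A
  · simpa using (hlim x).mul_const (f x)

/-- The cutoff adds only `b · ∇χₙ Ψ`, of size `D C A₀ / (n + 1)`. Hence `A₀` is absent from the
limiting estimate. -/
theorem HasEvolution.abs_integral_sub_le (hν : IsNarrowlyContinuous ν)
    (hbw : IsBoundedContinuousCoeff b w C) (h : HasEvolution b w μ₀ ν) {Ψ : ℝ × Rd d → ℝ}
    (hΨ : ContDiff ℝ 1 Ψ) {s t : ℝ≥0} (hst : s ≤ t) {A₀ A₁ V : ℝ}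
    (hA₀ : ∀ r ∈ Icc s t, ∀ x, |Ψ (r, x)| ≤ A₀)
    (hA₁ : ∀ r ∈ Icc s t, ∀ x, |generator b w Ψ r x| ≤ A₁)
    (hV : ∀ r ∈ Icc s t, totalMass (ν r) ≤ V) :
    |(∫ᵛ x, Ψ (t, x) ∂•(ν t)) - ∫ᵛ x, Ψ (s, x) ∂•(ν s)| ≤ A₁ * V * (t - s) := by
  obtain ⟨χ, D, hD, hχ, hχc, hχ1, hχd, hlim⟩ := exists_cutoff_sequence d
  have hC : 0 ≤ C := (norm_nonneg _).trans (hbw.norm_drift_le 0 0)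
  have hA₀0 : 0 ≤ A₀ := (abs_nonneg _).trans (hA₀ s ⟨le_rfl, hst⟩ 0)
  have hA₁0 : 0 ≤ A₁ := (abs_nonneg _).trans (hA₁ s ⟨le_rfl, hst⟩ 0)
  have hst' : (s : ℝ) ≤ t := NNReal.coe_le_coe.2 hst
  have hcont : ∀ r : ℝ, Continuous fun x => Ψ (r, x) := fun r =>
    hΨ.continuous.comp (by fun_prop)
  have hl := ((tendsto_integral_cutoff_mul (ν t) (fun n => (hχ n).continuous) hχ1 hlim (hcont t)
    (hA₀ t ⟨hst, le_rfl⟩)).sub (tendsto_integral_cutoff_mul (ν s) (fun n => (hχ n).continuous)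
    hχ1 hlim (hcont s) (hA₀ s ⟨le_rfl, hst⟩))).abs
  have hr : Tendsto (fun n : ℕ => (A₁ + D * C * A₀ * (1 / ((n : ℝ) + 1))) * V * (t - s)) atTop
      (𝓝 (A₁ * V * (t - s))) := by
    have := ((tendsto_one_div_add_atTop_nhds_zero_nat (𝕜 := ℝ)).const_mul (D * C * A₀)).const_add A₁
    simpa using (this.mul_const V).mul_const ((t : ℝ) - s)
  refine le_of_tendsto_of_tendsto' hl hr fun n => ?_
  have hK := hχc n
  have hsupp : IsSpatiallySupportedIn (tsupport (χ n)) fun p => χ n p.2 * Ψ p :=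
    IsSpatiallySupportedIn.of_forall (isClosed_tsupport _) fun r x hx => by
      simp [image_eq_zero_of_notMem_tsupport hx]
  have hΦ : ContDiff ℝ 1 fun p : ℝ × Rd d => χ n p.2 * Ψ p := ((hχ n).comp contDiff_snd).mul hΨ
  have e := h.sub_eq_integral hν hbw hΦ hK hsupp s t
  simp only at e
  rw [e, ← abs_of_nonneg (sub_nonneg.2 hst'), ← Real.norm_eq_abs]
  refine intervalIntegral.norm_integral_le_of_norm_le_const fun r hr => ?_
  rw [uIoc_of_le hst'] at hr
  have hrI : r.toNNReal ∈ Icc s t :=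
    ⟨NNReal.le_toNNReal_of_coe_le hr.1.le, Real.toNNReal_le_iff_le_coe.2 hr.2⟩
  refine (abs_integral_le _ (C := A₁ + D * C * A₀ * (1 / ((n : ℝ) + 1))) fun x => ?_).trans
    (mul_le_mul_of_nonneg_left (hV _ hrI) (by positivity))
  rw [generator_space_mul hΨ (hχ n)]
  refine (abs_add_le _ _).trans (add_le_add ?_ ?_)
  · rw [abs_mul]
    calc |χ n x| * |generator b w Ψ r.toNNReal x| ≤ 1 * A₁ :=
          mul_le_mul (hχ1 n x) (hA₁ _ hrI x) (abs_nonneg _) zero_le_one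
      _ = A₁ := one_mul _
  · rw [abs_mul]
    have h1 : |fderiv ℝ (χ n) x (b r.toNNReal x)| ≤ D / (n + 1) * C :=
      ((fderiv ℝ (χ n) x).le_of_opNorm_le (hχd n x) _).trans
        (mul_le_mul_of_nonneg_left (hbw.norm_drift_le _ _) (by positivity))
    calc |fderiv ℝ (χ n) x (b r.toNNReal x)| * |Ψ (r.toNNReal, x)| ≤ D / (n + 1) * C * A₀ :=
          mul_le_mul h1 (hA₀ _ hrI x) (abs_nonneg _) (by positivity)
      _ = D * C * A₀ * (1 / ((n : ℝ) + 1)) := by ring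

end Cutoff

/-! ### Uniqueness for the linear problem by backward Euler steps -/

section Uniqueness

variable {d : ℕ} {b : ℝ≥0 → Rd d → Rd d} {w : ℝ≥0 → Rd d → ℝ} {C : ℝ} {ν : ℝ≥0 → M d} {μ₀ : M d}

/-- The function `(s, x) ↦ ψ(x + (τ - s) v(x)) (1 + (τ - s) m(x))`: the explicit Euler step for the
backward equation with coefficients frozen in time. -/
def eulerStep (ψ : Rd d → ℝ) (v : Rd d → Rd d) (m : Rd d → ℝ) (τ : ℝ) (p : ℝ × Rd d) : ℝ :=
  ψ (p.2 + (τ - p.1) • v p.2) * (1 + (τ - p.1) * m p.2)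

variable {ψ : Rd d → ℝ} {v : Rd d → Rd d} {m : Rd d → ℝ}

theorem contDiff_eulerStep (hψ : ContDiff ℝ 1 ψ) (hv : ContDiff ℝ 1 v) (hm : ContDiff ℝ 1 m)
    (τ : ℝ) : ContDiff ℝ 1 (eulerStep ψ v m τ) := by
  unfold eulerStep
  fun_prop

theorem fderiv_eulerStep_apply (hψ : ContDiff ℝ 1 ψ) (hv : ContDiff ℝ 1 v) (hm : ContDiff ℝ 1 m)
    (τ s : ℝ) (x : Rd d) (a : ℝ) (u : Rd d) :
    fderiv ℝ (eulerStep ψ v m τ) (s, x) (a, u) =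
      fderiv ℝ ψ (x + (τ - s) • v x) (u + (τ - s) • fderiv ℝ v x u - a • v x)
        * (1 + (τ - s) * m x) +
      ψ (x + (τ - s) • v x) * ((τ - s) * fderiv ℝ m x u - a * m x) := by
  have hs : HasFDerivAt (fun p : ℝ × Rd d => τ - p.1) (-(ContinuousLinearMap.fst ℝ ℝ (Rd d)))
      (s, x) := hasFDerivAt_fst.const_sub τ
  have hv' : HasFDerivAt (fun p : ℝ × Rd d => v p.2)
      ((fderiv ℝ v x).comp (ContinuousLinearMap.snd ℝ ℝ (Rd d))) (s, x) :=
    (hv.differentiable one_ne_zero x).hasFDerivAt.comp (s, x) hasFDerivAt_snd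
  have hm' : HasFDerivAt (fun p : ℝ × Rd d => m p.2)
      ((fderiv ℝ m x).comp (ContinuousLinearMap.snd ℝ ℝ (Rd d))) (s, x) :=
    (hm.differentiable one_ne_zero x).hasFDerivAt.comp (s, x) hasFDerivAt_snd
  have hY : HasFDerivAt (fun p : ℝ × Rd d => p.2 + (τ - p.1) • v p.2) _ (s, x) :=
    hasFDerivAt_snd.add (hs.smul hv')
  have hψ' : HasFDerivAt (fun p : ℝ × Rd d => ψ (p.2 + (τ - p.1) • v p.2)) _ (s, x) :=
    HasFDerivAt.comp (s, x) (g := ψ)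
      (hψ.differentiable one_ne_zero (x + (τ - s) • v x)).hasFDerivAt hY
  have hR : HasFDerivAt (fun p : ℝ × Rd d => 1 + (τ - p.1) * m p.2) _ (s, x) :=
    (hs.mul hm').const_add 1
  have hE : HasFDerivAt (eulerStep ψ v m τ) _ (s, x) := hψ'.mul hR
  rw [hE.fderiv]
  simp
  ring

/-- The `C^1` bounds `|ψ| ≤ A` and `|∇ψ| ≤ A`. -/
structure IsC1BoundedBy {F : Type*} [NormedAddCommGroup F] [NormedSpace ℝ F] (f : Rd d → F)
    (A : ℝ) : Prop where
  contDiff : ContDiff ℝ 1 f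
  norm_le : ∀ x, ‖f x‖ ≤ A
  norm_fderiv_le : ∀ x, ‖fderiv ℝ f x‖ ≤ A

theorem IsC1BoundedBy.nonneg {F : Type*} [NormedAddCommGroup F] [NormedSpace ℝ F] {f : Rd d → F}
    {A : ℝ} (hf : IsC1BoundedBy f A) : 0 ≤ A := (norm_nonneg _).trans (hf.norm_le 0)

/-- Stability without loss of derivatives, so the step can be iterated. The gradient bound comes
from `(1 + hC)² + hC = 1 + h (3C + hC²)` and `h ≤ 1`. -/
theorem IsC1BoundedBy.eulerStep_slice {A : ℝ} (hψ : IsC1BoundedBy ψ A) (hv : IsC1BoundedBy v C)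
    (hm : IsC1BoundedBy m C) {h : ℝ} (h0 : 0 ≤ h) (h1 : h ≤ 1) (s : ℝ) :
    IsC1BoundedBy (fun x => eulerStep ψ v m (s + h) (s, x)) (A * (1 + h * (3 * C + C ^ 2))) := by
  have hC := hv.nonneg
  have hA := hψ.nonneg
  have hτ : s + h - s = h := by ring
  have hrate : ∀ x, |1 + h * m x| ≤ 1 + h * C := fun x => by
    refine (abs_add_le _ _).trans ?_
    rw [abs_one, abs_mul, abs_of_nonneg h0]
    gcongr
    exact hm.norm_le x
  have hcd := contDiff_eulerStep hψ.contDiff hv.contDiff hm.contDiff (s + h)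
  have hmk : ContDiff ℝ 1 fun x : Rd d => (s, x) := by fun_prop
  refine ⟨hcd.comp hmk, fun x => ?_, fun x => ?_⟩
  · simp only [eulerStep, hτ, norm_mul]
    calc ‖ψ (x + h • v x)‖ * ‖1 + h * m x‖ ≤ A * (1 + h * C) :=
          mul_le_mul (hψ.norm_le _) (hrate x) (norm_nonneg _) hA
      _ ≤ A * (1 + h * (3 * C + C ^ 2)) := by gcongr; nlinarith [sq_nonneg C]
  · refine ContinuousLinearMap.opNorm_le_bound _ (by positivity) fun u => ?_
    have hd : HasFDerivAt (fun x : Rd d => eulerStep ψ v m (s + h) (s, x))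
        ((fderiv ℝ (eulerStep ψ v m (s + h)) (s, x)).comp
          (ContinuousLinearMap.inr ℝ ℝ (Rd d))) x :=
      HasFDerivAt.comp x (g := eulerStep ψ v m (s + h))
        (hcd.differentiable one_ne_zero (s, x)).hasFDerivAt (hasFDerivAt_prodMk_right s x)
    rw [hd.fderiv]
    change ‖fderiv ℝ (eulerStep ψ v m (s + h)) (s, x) (0, u)‖ ≤ _
    rw [fderiv_eulerStep_apply hψ.contDiff hv.contDiff hm.contDiff, hτ]
    simp only [zero_smul, sub_zero, zero_mul]
    have b1 : ‖u + h • fderiv ℝ v x u‖ ≤ (1 + h * C) * ‖u‖ := by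
      refine (norm_add_le _ _).trans ?_
      rw [norm_smul, Real.norm_of_nonneg h0, add_mul, one_mul, mul_assoc]
      gcongr
      exact (fderiv ℝ v x).le_of_opNorm_le (hv.norm_fderiv_le x) u
    have b2 : ‖fderiv ℝ ψ (x + h • v x) (u + h • fderiv ℝ v x u)‖ ≤ A * ((1 + h * C) * ‖u‖) :=
      ((fderiv ℝ ψ _).le_of_opNorm_le (hψ.norm_fderiv_le _) _).trans (by gcongr)
    have b3 : ‖h * fderiv ℝ m x u‖ ≤ h * (C * ‖u‖) := by
      rw [norm_mul, Real.norm_of_nonneg h0]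
      gcongr
      exact (fderiv ℝ m x).le_of_opNorm_le (hm.norm_fderiv_le x) u
    refine (norm_add_le _ _).trans ?_
    rw [norm_mul, norm_mul]
    calc ‖fderiv ℝ ψ (x + h • v x) (u + h • fderiv ℝ v x u)‖ * ‖1 + h * m x‖ +
          ‖ψ (x + h • v x)‖ * ‖h * fderiv ℝ m x u‖
        ≤ A * ((1 + h * C) * ‖u‖) * (1 + h * C) + A * (h * (C * ‖u‖)) := by
          gcongr
          · exact hrate x
          · exact hψ.norm_le _
      _ = A * (1 + h * (3 * C + h * C ^ 2)) * ‖u‖ := by ring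
      _ ≤ A * (1 + h * (3 * C + C ^ 2)) * ‖u‖ := by
          gcongr
          nlinarith [sq_nonneg C]

/-- Consistency: the time derivative of the Euler step cancels the frozen transport and reaction
terms at leading order. What survives is the freezing error `η` and terms carrying the factor `τ ≤
h`. -/
theorem abs_generator_eulerStep_le {A : ℝ} (hψ : IsC1BoundedBy ψ A) {t r : ℝ≥0} {h η : ℝ}
    (hbt : IsC1BoundedBy (b t) C) (hwt : IsC1BoundedBy (w t) C)
    (hbr : ∀ x, ‖b r x‖ ≤ C) (hwr : ∀ x, |w r x| ≤ C)
    (hbη : ∀ x, ‖b r x - b t x‖ ≤ η) (hwη : ∀ x, |w r x - w t x| ≤ η)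
    (htr : (t : ℝ) ≤ r) (hrh : (r : ℝ) ≤ t + h) (h1 : h ≤ 1) (x : Rd d) :
    |generator b w (eulerStep ψ (b t) (w t) (t + h)) r x| ≤
      A * ((2 + C) * η + h * (C ^ 3 + 3 * C ^ 2)) := by
  have hC := hbt.nonneg
  have hA := hψ.nonneg
  have hη : 0 ≤ η := (norm_nonneg _).trans (hbη 0)
  set τ : ℝ := t + h - r with hτ
  have hτ0 : 0 ≤ τ := by linarith
  have hτh : τ ≤ h := by linarith
  have h0 : 0 ≤ h := hτ0.trans hτh
  set y : Rd d := x + τ • b t x with hy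
  have e : generator b w (eulerStep ψ (b t) (w t) (t + h)) r x =
      fderiv ℝ ψ y ((b r x - b t x) + τ • fderiv ℝ (b t) x (b r x)) * (1 + τ * w t x) +
      ψ y * (τ * fderiv ℝ (w t) x (b r x) + (w r x - w t x) + τ * (w r x * w t x)) := by
    simp only [generator, fderiv_eulerStep_apply hψ.contDiff hbt.contDiff hwt.contDiff, ← hτ, ← hy]
    simp only [eulerStep, ← hτ, ← hy, map_zero, smul_zero, zero_add, one_smul, map_sub, map_add,
      map_smul, smul_eq_mul, zero_smul, zero_mul]
    ring
  have b1 : ‖(b r x - b t x) + τ • fderiv ℝ (b t) x (b r x)‖ ≤ η + h * (C * C) := by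
    refine (norm_add_le _ _).trans (add_le_add (hbη x) ?_)
    rw [norm_smul, Real.norm_of_nonneg hτ0]
    gcongr
    exact ((fderiv ℝ (b t) x).le_of_opNorm_le (hbt.norm_fderiv_le x) _).trans
      (by gcongr; exact hbr x)
  have b2 : ‖fderiv ℝ ψ y ((b r x - b t x) + τ • fderiv ℝ (b t) x (b r x))‖ ≤
      A * (η + h * (C * C)) :=
    ((fderiv ℝ ψ y).le_of_opNorm_le (hψ.norm_fderiv_le y) _).trans (by gcongr)
  have b3 : ‖1 + τ * w t x‖ ≤ 1 + C := by
    refine (norm_add_le _ _).trans ?_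
    rw [norm_one, norm_mul, Real.norm_of_nonneg hτ0]
    have : τ * ‖w t x‖ ≤ 1 * C :=
      mul_le_mul (hτh.trans h1) (hwt.norm_le x) (norm_nonneg _) zero_le_one
    linarith
  have b4 : ‖τ * fderiv ℝ (w t) x (b r x) + (w r x - w t x) + τ * (w r x * w t x)‖ ≤
      h * (C * C) + η + h * (C * C) := by
    refine (norm_add₃_le).trans ?_
    rw [norm_mul, norm_mul, norm_mul, Real.norm_of_nonneg hτ0]
    gcongr
    · exact ((fderiv ℝ (w t) x).le_of_opNorm_le (hwt.norm_fderiv_le x) _).trans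
        (by gcongr; exact hbr x)
    · exact hwη x
    · exact hwr x
    · exact hwt.norm_le x
  rw [e, ← Real.norm_eq_abs]
  refine (norm_add_le _ _).trans ?_
  rw [norm_mul, norm_mul]
  calc _ ≤ A * (η + h * (C * C)) * (1 + C) + A * (h * (C * C) + η + h * (C * C)) := by
        gcongr
        exact hψ.norm_le y
    _ = A * ((2 + C) * η + h * (C ^ 3 + 3 * C ^ 2)) := by ring

/-- Coefficients that are of class `C^1` in space, with uniform bounds on bounded time intervals,
and uniformly continuous in time in the supremum norm. -/
structure IsC1Coeff (b : ℝ≥0 → Rd d → Rd d) (w : ℝ≥0 → Rd d → ℝ) : Prop where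
  exists_bound : ∀ T : ℝ≥0, ∃ C : ℝ, ∀ t ≤ T, IsC1BoundedBy (b t) C ∧ IsC1BoundedBy (w t) C
  uniform : ∀ T : ℝ≥0, ∀ ε > 0, ∃ δ > 0, ∀ s ≤ T, ∀ t ≤ T, dist s t ≤ δ →
    ∀ x, ‖b s x - b t x‖ ≤ ε ∧ |w s x - w t x| ≤ ε

/-- Here `δ` bounds the measure as a functional on `C^1` functions. Pairing with the Euler step,
which equals `ψ` at time `t + h`, gives a recursion: stability multiplies `δ`, and the residual adds
an error proportional to `h`. -/
theorem HasEvolution.abs_integral_step_le (hν : IsNarrowlyContinuous ν)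
    (hbw : IsBoundedContinuousCoeff b w C) (hev : HasEvolution b w μ₀ ν) {t h : ℝ≥0} (h1 : h ≤ 1)
    {L η V δ : ℝ} (hb : ∀ r ∈ Icc t (t + h), IsC1BoundedBy (b r) L ∧ IsC1BoundedBy (w r) L)
    (hη : ∀ r ∈ Icc t (t + h), ∀ x, ‖b r x - b t x‖ ≤ η ∧ |w r x - w t x| ≤ η)
    (hV : ∀ r ∈ Icc t (t + h), totalMass (ν r) ≤ V)
    (hδ : ∀ ψ A, IsC1BoundedBy ψ A → |∫ᵛ x, ψ x ∂•(ν t)| ≤ δ * A) {ψ : Rd d → ℝ} {A : ℝ}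
    (hψ : IsC1BoundedBy ψ A) :
    |∫ᵛ x, ψ x ∂•(ν (t + h))| ≤
      (δ * (1 + h * (3 * L + L ^ 2)) + h * (V * ((2 + L) * η + h * (L ^ 3 + 3 * L ^ 2)))) * A := by
  have hle : t ≤ t + h := le_self_add
  have htI : t ∈ Icc t (t + h) := ⟨le_rfl, hle⟩
  obtain ⟨hbt, hwt⟩ := hb t htI
  have hL := hbt.nonneg
  have hA := hψ.nonneg
  have h1' : (h : ℝ) ≤ 1 := by exact_mod_cast h1
  have hΨ := contDiff_eulerStep hψ.contDiff hbt.contDiff hwt.contDiff ((t : ℝ) + h)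
  have hbound : ∀ r ∈ Icc t (t + h), ∀ x, |eulerStep ψ (b t) (w t) ((t : ℝ) + h) (r, x)| ≤
      A * (1 + L) := by
    intro r hr x
    have e1 : (t : ℝ) ≤ r := by exact_mod_cast hr.1
    have e2 : (r : ℝ) ≤ t + h := by exact_mod_cast hr.2
    have hτ0 : 0 ≤ (t : ℝ) + h - r := by linarith
    simp only [eulerStep, abs_mul]
    refine mul_le_mul (hψ.norm_le _) ?_ (abs_nonneg _) hA
    refine (abs_add_le _ _).trans ?_
    rw [abs_one, abs_mul, abs_of_nonneg hτ0]
    have : ((t : ℝ) + h - r) * |w t x| ≤ 1 * L :=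
      mul_le_mul (by linarith) (hwt.norm_le x) (abs_nonneg _) zero_le_one
    linarith
  have hgen : ∀ r ∈ Icc t (t + h), ∀ x,
      |generator b w (eulerStep ψ (b t) (w t) ((t : ℝ) + h)) r x| ≤
      A * ((2 + L) * η + h * (L ^ 3 + 3 * L ^ 2)) := fun r hr x =>
    abs_generator_eulerStep_le hψ hbt hwt (hb r hr).1.norm_le (hb r hr).2.norm_le
      (fun x => (hη r hr x).1) (fun x => (hη r hr x).2) (by exact_mod_cast hr.1)
      (by exact_mod_cast hr.2) h1' x
  have key := hev.abs_integral_sub_le hν hbw hΨ hle hbound hgen hV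
  have hstart := hδ _ _ (hψ.eulerStep_slice hbt hwt h.2 h1' t)
  have hend : ∀ x, eulerStep ψ (b t) (w t) ((t : ℝ) + h) (((t + h : ℝ≥0) : ℝ), x) = ψ x := by
    intro x
    simp [eulerStep]
  simp only [hend] at key
  push_cast at key
  have := abs_sub_abs_le_abs_sub (∫ᵛ x, ψ x ∂•(ν (t + h)))
    (∫ᵛ x, eulerStep ψ (b t) (w t) ((t : ℝ) + h) (t, x) ∂•(ν t))
  have e3 : (t : ℝ) + h - t = h := by ring
  rw [e3] at key
  change |∫ᵛ x, eulerStep ψ (b t) (w t) ((t : ℝ) + h) (t, x) ∂•(ν t)| ≤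
    δ * (A * (1 + (h : ℝ) * (3 * L + L ^ 2))) at hstart
  calc _ ≤ δ * (A * (1 + (h : ℝ) * (3 * L + L ^ 2))) +
      A * ((2 + L) * η + h * (L ^ 3 + 3 * L ^ 2)) * V * h := by linarith
    _ = _ := by ring

theorem HasEvolution.eq_zero (hν : IsNarrowlyContinuous ν)
    (hbw : IsBoundedContinuousCoeff b w C) (hev : HasEvolution b w 0 ν) (hc : IsC1Coeff b w)
    (T : ℝ≥0) : ν T = 0 := by
  have hν0 : ν 0 = 0 := hev.initial_eq
  obtain ⟨V, hV⟩ := hν.exists_totalMass_le T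
  obtain ⟨L, hL⟩ := hc.exists_bound T
  have hL0 : 0 ≤ L := (hL 0 zero_le).1.nonneg
  have hV0 : 0 ≤ V := (totalMass_nonneg _).trans (hV 0 zero_le)
  set Q : ℝ := 3 * L + L ^ 2 with hQ
  have hQ0 : 0 ≤ Q := by positivity
  have step : ∀ ε : ℝ, 0 < ε → ∀ ψ A, IsC1BoundedBy ψ A → |∫ᵛ x, ψ x ∂•(ν T)| ≤
      T * (V * ((2 + L) * ε + ε * (L ^ 3 + 3 * L ^ 2))) * Real.exp (T * Q) * A := by
    intro ε hε ψ A hψ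
    have hA := hψ.nonneg
    obtain ⟨δ, hδ, hδc⟩ := hc.uniform T ε hε
    -- The step `T / n` lies below `δ` (coefficients vary by at most `ε`), below `ε` (first-order
    -- residual) and below 1 (stability).
    obtain ⟨n, hn⟩ := exists_nat_gt ((T : ℝ) / min δ (min ε 1))
    have hn0 : (0 : ℝ) < n := lt_of_le_of_lt (by positivity) hn
    have hnN : n ≠ 0 := by rintro rfl; simp at hn0
    set h : ℝ≥0 := T / n with hh
    have hhr : (h : ℝ) = T / n := by simp [hh]
    have hhlt : (h : ℝ) < min δ (min ε 1) := by
      rw [hhr, div_lt_iff₀ hn0]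
      rw [div_lt_iff₀ (by positivity)] at hn
      linarith
    have hhδ : (h : ℝ) ≤ δ := hhlt.le.trans (min_le_left _ _)
    have hhε : (h : ℝ) ≤ ε := hhlt.le.trans ((min_le_right _ _).trans (min_le_left _ _))
    have hh1 : h ≤ 1 := by
      have : (h : ℝ) ≤ 1 := hhlt.le.trans ((min_le_right _ _).trans (min_le_right _ _))
      exact_mod_cast this
    have hnh : (n : ℝ≥0) * h = T := by
      rw [hh]
      field_simp
    set E : ℝ := V * ((2 + L) * ε + h * (L ^ 3 + 3 * L ^ 2)) with hE
    have hE0 : 0 ≤ E := by positivity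
    -- Discrete Gronwall for `δₖ₊₁ = (1 + hQ) δₖ + hE` with `δ₀ = 0`. The claim is for all `ψ` at
    -- once, since each step changes the test function.
    have ind : ∀ k : ℕ, k ≤ n → ∀ ψ A, IsC1BoundedBy ψ A →
        |∫ᵛ x, ψ x ∂•(ν (k * h))| ≤ k * (h * E) * (1 + h * Q) ^ k * A := by
      intro k
      induction k with
      | zero =>
        intro _ ψ A _
        simp [hν0]
      | succ k ih =>
        intro hk ψ A hψ
        have hkT : (k : ℝ≥0) * h + h ≤ T := by
          calc (k : ℝ≥0) * h + h = ((k + 1 : ℕ) : ℝ≥0) * h := by push_cast; ring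
            _ ≤ n * h := by gcongr
            _ = T := hnh
        have hI : ∀ r ∈ Icc ((k : ℝ≥0) * h) (k * h + h), r ≤ T := fun r hr => hr.2.trans hkT
        have := hev.abs_integral_step_le hν hbw hh1 (fun r hr => hL r (hI r hr))
          (η := ε) (fun r hr => hδc r (hI r hr) (k * h) (le_self_add.trans hkT) (by
            have e1 : (((k : ℝ≥0) * h : ℝ≥0) : ℝ) ≤ r := by exact_mod_cast hr.1
            have e2 : (r : ℝ) ≤ ((k : ℝ≥0) * h : ℝ≥0) + h := by exact_mod_cast hr.2
            rw [NNReal.dist_eq, abs_of_nonneg (sub_nonneg.2 e1)]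
            linarith)) (fun r hr => hV r (hI r hr))
          (ih (by omega)) hψ
        rw [show (((k + 1 : ℕ) : ℝ≥0) * h) = k * h + h by push_cast; ring]
        refine this.trans (mul_le_mul_of_nonneg_right ?_ hψ.nonneg)
        rw [← hQ, ← hE]
        have hp : 1 ≤ (1 + (h : ℝ) * Q) ^ (k + 1) := one_le_pow₀ (by
          have : 0 ≤ (h : ℝ) * Q := by positivity
          linarith)
        have hhE : 0 ≤ (h : ℝ) * E := by positivity
        calc k * (h * E) * (1 + h * Q) ^ k * (1 + h * Q) + h * E
            = k * (h * E) * (1 + h * Q) ^ (k + 1) + h * E * 1 := by ring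
          _ ≤ k * (h * E) * (1 + h * Q) ^ (k + 1) + h * E * (1 + h * Q) ^ (k + 1) := by gcongr
          _ = ((k + 1 : ℕ) : ℝ) * (h * E) * (1 + h * Q) ^ (k + 1) := by push_cast; ring
    have hfin := ind n le_rfl ψ A hψ
    rw [hnh] at hfin
    have hnhr : (n : ℝ) * h = T := by exact_mod_cast congrArg NNReal.toReal hnh
    have hexp : (1 + (h : ℝ) * Q) ^ n ≤ Real.exp (T * Q) := by
      calc (1 + (h : ℝ) * Q) ^ n ≤ Real.exp (h * Q) ^ n := by
            gcongr
            linarith [Real.add_one_le_exp ((h : ℝ) * Q)]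
        _ = Real.exp (T * Q) := by
            rw [← Real.exp_nat_mul, ← hnhr, mul_assoc]
    refine hfin.trans (mul_le_mul_of_nonneg_right ?_ hA)
    have hEle : E ≤ V * ((2 + L) * ε + ε * (L ^ 3 + 3 * L ^ 2)) := by
      rw [hE]
      gcongr
    rw [← mul_assoc, hnhr]
    gcongr
  refine eq_of_forall_integral_contDiff_eq fun ψ hψ hψc => ?_
  rw [VectorMeasure.integral_zero_vectorMeasure]
  have hψ1 : ContDiff ℝ 1 ψ := hψ.of_le (by norm_cast)
  obtain ⟨A₁, hA₁⟩ := hψc.exists_bound_of_continuous hψ1.continuous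
  obtain ⟨A₂, hA₂⟩ := (hψc.fderiv ℝ).exists_bound_of_continuous
    (hψ1.continuous_fderiv one_ne_zero)
  have hψA : IsC1BoundedBy ψ (max A₁ A₂) := ⟨hψ1, fun x => (hA₁ x).trans (le_max_left _ _),
    fun x => (hA₂ x).trans (le_max_right _ _)⟩
  have hlim : Tendsto (fun ε : ℝ => T * (V * ((2 + L) * ε + ε * (L ^ 3 + 3 * L ^ 2))) *
      Real.exp (T * Q) * max A₁ A₂) (𝓝[>] 0) (𝓝 0) := by
    have hcont : Continuous fun ε : ℝ => T * (V * ((2 + L) * ε + ε * (L ^ 3 + 3 * L ^ 2))) *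
      Real.exp (T * Q) * max A₁ A₂ := by fun_prop
    have := hcont.tendsto 0
    simp only [mul_zero, zero_mul, add_zero] at this
    exact this.mono_left nhdsWithin_le_nhds
  exact abs_nonpos_iff.1 (ge_of_tendsto hlim (eventually_nhdsWithin_of_forall fun ε hε =>
    step ε hε ψ _ hψA))

end Uniqueness

/-! ### Regularity of the kernel coefficients and continuity in `Z` -/

section Coefficients

variable {d : ℕ} {α : ℝ}

theorem HolderSpace.norm_fderiv_le {E F : Type*} [NormedAddCommGroup E] [NormedSpace ℝ E]
    [NormedAddCommGroup F] [NormedSpace ℝ F] (f : HolderSpace α E F) (x : E) :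
    ‖fderiv ℝ f x‖ ≤ ‖f‖ := by
  have h1 : ‖fderiv ℝ f x‖ ≤ ⨆ x, ‖fderiv ℝ f x‖ := le_ciSup f.bddAbove_norm_fderiv x
  have h2 : 0 ≤ ⨆ x, ‖f x‖ := Real.iSup_nonneg fun x => norm_nonneg _
  have h3 : 0 ≤ ⨆ p : E × E, ‖fderiv ℝ f p.1 - fderiv ℝ f p.2‖ / ‖p.1 - p.2‖ ^ α :=
    Real.iSup_nonneg fun p => by positivity
  rw [HolderSpace.norm_def]
  linarith

/-- At distances at most 1 the Lipschitz bound suffices, as `α ≤ 1`; at larger distances the sup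
bound does, as `‖x - y‖ ^ α ≥ 1`. -/
theorem isC1Holder_of_contDiff_of_hasCompactSupport (hα : 0 < α) (hα' : α ≤ 1) {ψ : Rd d → ℝ}
    (hψ : ContDiff ℝ 2 ψ) (hc : HasCompactSupport ψ) : IsC1Holder α ψ := by
  have hd : ContDiff ℝ 1 (fderiv ℝ ψ) := hψ.fderiv_right (by norm_num)
  have hdc : HasCompactSupport (fderiv ℝ ψ) := hc.fderiv ℝ
  obtain ⟨D, hD⟩ := hdc.exists_bound_of_continuous hd.continuous
  obtain ⟨L, hL⟩ := hd.lipschitzWith_of_hasCompactSupport hdc one_ne_zero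
  refine ⟨hψ.of_le (by norm_num), hc.exists_bound_of_continuous hψ.continuous, ⟨D, hD⟩,
    ⟨L + 2 * D, fun x y => ?_⟩⟩
  have hD0 : 0 ≤ D := (norm_nonneg _).trans (hD 0)
  rcases eq_or_ne x y with rfl | hxy
  · rw [sub_self, norm_zero]
    positivity
  have hpos : 0 < ‖x - y‖ := norm_pos_iff.2 (sub_ne_zero.2 hxy)
  rcases le_total ‖x - y‖ 1 with h | h
  · calc ‖fderiv ℝ ψ x - fderiv ℝ ψ y‖ ≤ L * ‖x - y‖ := hL.norm_sub_le x y
      _ = L * ‖x - y‖ ^ (1 : ℝ) := by rw [Real.rpow_one]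
      _ ≤ (L + 2 * D) * ‖x - y‖ ^ α :=
        mul_le_mul (by linarith) (Real.rpow_le_rpow_of_exponent_ge hpos h hα') (by positivity)
          (by positivity)
  · calc ‖fderiv ℝ ψ x - fderiv ℝ ψ y‖ ≤ ‖fderiv ℝ ψ x‖ + ‖fderiv ℝ ψ y‖ := norm_sub_le _ _
      _ ≤ D + D := add_le_add (hD x) (hD y)
      _ ≤ (L + 2 * D) * 1 := by linarith [L.2]
      _ ≤ (L + 2 * D) * ‖x - y‖ ^ α := by
        gcongr
        exact Real.one_le_rpow h hα.le

theorem toDual_injective (hα : 0 < α) (hα' : α ≤ 1) :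
    Function.Injective (toDual α : M d → HolderSpace α (Rd d) ℝ →L[ℝ] ℝ) := fun μ ν h =>
  eq_of_forall_integral_contDiff_eq fun ψ hψ hc =>
    DFunLike.congr_fun h (HolderSpace.mk ψ
      (isC1Holder_of_contDiff_of_hasCompactSupport hα hα' (hψ.of_le (by norm_cast)) hc))

theorem measureToZ_injective (hα : 0 < α) (hα' : α ≤ 1) :
    Function.Injective (measureToZ α : M d → Z α d) := fun _ _ h =>
  toDual_injective hα hα' (congrArg Subtype.val h)

/-- Narrow continuity handles the fixed function `K x₀`, and the local mass bound handles `K x - K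
x₀`. Continuity of the coefficients is thus available before continuity in `Z` is known. -/
theorem IsNarrowlyContinuous.continuous_toDual_kernel {ν : ℝ≥0 → M d}
    (hν : IsNarrowlyContinuous ν) (K : HolderSpace α (Rd d) (HolderSpace α (Rd d) ℝ)) :
    Continuous fun p : ℝ≥0 × Rd d => toDual α (ν p.1) (K p.2) := by
  rw [continuous_iff_continuousAt]
  rintro ⟨t₀, x₀⟩
  obtain ⟨V, hV⟩ := hν.exists_totalMass_le (t₀ + 1)
  let f : Rd d →ᵇ ℝ := BoundedContinuousFunction.ofNormedAddCommGroup (K x₀)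
    (K x₀).isC1Holder.contDiff.continuous ‖K x₀‖ (K x₀).norm_apply_le
  have h1 : Tendsto (fun p : ℝ≥0 × Rd d => toDual α (ν p.1) (K x₀)) (𝓝 (t₀, x₀))
      (𝓝 (toDual α (ν t₀) (K x₀))) := ((hν f).comp continuous_fst).tendsto (t₀, x₀)
  have hKc : Continuous K := K.isC1Holder.contDiff.continuous
  have h2 : Tendsto (fun p : ℝ≥0 × Rd d => toDual α (ν p.1) (K p.2 - K x₀)) (𝓝 (t₀, x₀))
      (𝓝 0) := by
    have hlim : Tendsto (fun p : ℝ≥0 × Rd d => ‖K p.2 - K x₀‖ * V) (𝓝 (t₀, x₀)) (𝓝 0) := by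
      have hc : Continuous fun p : ℝ≥0 × Rd d => ‖K p.2 - K x₀‖ * V := by fun_prop
      simpa using hc.tendsto (t₀, x₀)
    refine squeeze_zero_norm' ?_ hlim
    have hT : ∀ᶠ p : ℝ≥0 × Rd d in 𝓝 (t₀, x₀), p.1 < t₀ + 1 :=
      (continuous_fst.tendsto (t₀, x₀)).eventually (gt_mem_nhds (by simp))
    filter_upwards [hT] with p hp
    refine (abs_integral_le (ν p.1) (K p.2 - K x₀).norm_apply_le).trans ?_
    gcongr
    exact hV _ hp.le
  have h3 := h2.add h1
  rw [zero_add] at h3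
  refine h3.congr fun p => ?_
  rw [map_sub, sub_add_cancel]

variable {F : Type*} [NormedAddCommGroup F] [NormedSpace ℝ F]

theorem IsC2Holder.exists_bound {v : ℝ → F} (hv : IsC2Holder α v) : ∃ C : ℝ, 0 ≤ C ∧
    (∀ s, ‖v s‖ ≤ C) ∧ (∀ s, ‖fderiv ℝ v s‖ ≤ C) ∧ ∀ s t, ‖v s - v t‖ ≤ C * |s - t| := by
  obtain ⟨A, hA⟩ := hv.bounded
  obtain ⟨A', hA'⟩ := hv.bounded_deriv
  have hdiff : Differentiable ℝ v := hv.contDiff.differentiable two_ne_zero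
  refine ⟨max A A', ((norm_nonneg _).trans (hA 0)).trans (le_max_left _ _),
    fun s => (hA s).trans (le_max_left _ _), fun s => ?_, fun s t => ?_⟩
  · rw [← norm_deriv_eq_norm_fderiv]
    exact (hA' s).trans (le_max_right _ _)
  · exact convex_univ.norm_image_sub_le_of_norm_deriv_le (fun x _ => hdiff x)
      (fun x _ => (hA' x).trans (le_max_right _ _)) (mem_univ t) (mem_univ s)

theorem IsC1BoundedBy.mono {f : Rd d → F} {A B : ℝ} (hf : IsC1BoundedBy f A) (h : A ≤ B) :
    IsC1BoundedBy f B :=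
  ⟨hf.contDiff, fun x => (hf.norm_le x).trans h, fun x => (hf.norm_fderiv_le x).trans h⟩

theorem isC1BoundedBy_comp_kernel {v : ℝ → F} (hv : ContDiff ℝ 1 v) {C : ℝ} (hC : 0 ≤ C)
    (hv0 : ∀ s, ‖v s‖ ≤ C) (hv1 : ∀ s, ‖fderiv ℝ v s‖ ≤ C)
    (K : HolderSpace α (Rd d) (HolderSpace α (Rd d) ℝ)) (ζ : HolderSpace α (Rd d) ℝ →L[ℝ] ℝ) :
    IsC1BoundedBy (fun x => v (ζ (K x))) (C * (1 + ‖ζ‖ * ‖K‖)) := by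
  refine ⟨hv.comp (ζ.contDiff.comp K.isC1Holder.contDiff), fun x => (hv0 _).trans ?_, fun x => ?_⟩
  · exact le_mul_of_one_le_right hC (by
      have : 0 ≤ ‖ζ‖ * ‖K‖ := by positivity
      linarith)
  · have h1 : HasFDerivAt (fun x => ζ (K x)) (ζ.comp (fderiv ℝ K x)) x :=
      ζ.hasFDerivAt.comp x (K.isC1Holder.differentiable x).hasFDerivAt
    have h2 : HasFDerivAt (fun x => v (ζ (K x))) ((fderiv ℝ v (ζ (K x))).comp
        (ζ.comp (fderiv ℝ K x))) x :=
      HasFDerivAt.comp x (g := v) (hv.differentiable one_ne_zero _).hasFDerivAt h1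
    rw [h2.fderiv]
    calc _ ≤ ‖fderiv ℝ v (ζ (K x))‖ * ‖ζ.comp (fderiv ℝ K x)‖ :=
          ContinuousLinearMap.opNorm_comp_le _ _
      _ ≤ C * (‖ζ‖ * ‖K‖) := by
          gcongr
          · exact hv1 _
          · exact (ContinuousLinearMap.opNorm_comp_le _ _).trans
              (by gcongr; exact K.norm_fderiv_le x)
      _ ≤ C * (1 + ‖ζ‖ * ‖K‖) := by gcongr; linarith

/-- All the functions `K x` lie in one ball of the Hölder space, so closeness in the dual norm gives
closeness of the coefficients uniformly in `x`. -/
theorem norm_comp_kernel_sub_le {G : Type*} [NormedAddCommGroup G] {v : ℝ → G} {C : ℝ} (hC : 0 ≤ C)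
    (hv : ∀ s t, ‖v s - v t‖ ≤ C * |s - t|)
    (K : HolderSpace α (Rd d) (HolderSpace α (Rd d) ℝ)) (ζ ξ : HolderSpace α (Rd d) ℝ →L[ℝ] ℝ)
    (x : Rd d) : ‖v (ζ (K x)) - v (ξ (K x))‖ ≤ C * ‖K‖ * ‖ζ - ξ‖ := by
  refine (hv _ _).trans ?_
  have : |ζ (K x) - ξ (K x)| ≤ ‖ζ - ξ‖ * ‖K‖ :=
    ((ζ - ξ).le_opNorm (K x)).trans (by gcongr; exact K.norm_apply_le x)
  calc C * |ζ (K x) - ξ (K x)| ≤ C * (‖ζ - ξ‖ * ‖K‖) := by gcongr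
    _ = _ := by ring

variable {v : ℝ → Rd d} {m : ℝ → ℝ} {Kv Km : HolderSpace α (Rd d) (HolderSpace α (Rd d) ℝ)}
  {ν : ℝ≥0 → M d}

theorem exists_isBoundedContinuousCoeff (hv : IsC2Holder α v) (hm : IsC2Holder α m)
    (hν : IsNarrowlyContinuous ν) : ∃ C, IsBoundedContinuousCoeff
      (fun t x => v (kernelIntegral Kv (ν t) x)) (fun t x => m (kernelIntegral Km (ν t) x)) C := by
  obtain ⟨A, -, hA, -⟩ := hv.exists_bound
  obtain ⟨B, -, hB, -⟩ := hm.exists_bound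
  -- `kernelIntegral K (ν t) x` is by definition `toDual α (ν t) (K x)`.
  exact ⟨max A B, hv.contDiff.continuous.comp (hν.continuous_toDual_kernel Kv),
    hm.contDiff.continuous.comp (hν.continuous_toDual_kernel Km),
    fun t x => (hA _).trans (le_max_left _ _), fun t x => (hB _).trans (le_max_right _ _)⟩

/-- Norm continuity on the compact interval `[0, T]` gives both a uniform bound for the functionals
and uniform continuity in time. -/
theorem isC1Coeff_kernel (hv : IsC2Holder α v) (hm : IsC2Holder α m)
    (hν : Continuous fun t => toDual α (ν t)) : IsC1Coeff
      (fun t x => v (kernelIntegral Kv (ν t) x)) fun t x => m (kernelIntegral Km (ν t) x) := by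
  obtain ⟨A, hA, hA0, hA1, hA2⟩ := hv.exists_bound
  obtain ⟨B, hB, hB0, hB1, hB2⟩ := hm.exists_bound
  refine ⟨fun T => ?_, fun T ε hε => ?_⟩
  · obtain ⟨N, hN⟩ := isCompact_Icc.exists_bound_of_continuousOn (s := Icc 0 T) hν.continuousOn
    refine ⟨max (A * (1 + N * ‖Kv‖)) (B * (1 + N * ‖Km‖)), fun t ht => ?_⟩
    have hNt := hN t ⟨zero_le, ht⟩
    exact ⟨(isC1BoundedBy_comp_kernel (hv.contDiff.of_le (by norm_num)) hA hA0 hA1 Kv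
        (toDual α (ν t))).mono (le_trans (by gcongr) (le_max_left _ _)),
      (isC1BoundedBy_comp_kernel (hm.contDiff.of_le (by norm_num)) hB hB0 hB1 Km
        (toDual α (ν t))).mono (le_trans (by gcongr) (le_max_right _ _))⟩
  · have hu := isCompact_Icc.uniformContinuousOn_of_continuous (s := Icc 0 T) hν.continuousOn
    set R : ℝ := A * ‖Kv‖ + B * ‖Km‖ with hR
    obtain ⟨δ, hδ, h⟩ := Metric.uniformContinuousOn_iff.1 hu (ε / (R + 1)) (by positivity)
    refine ⟨δ / 2, by positivity, fun s hs t ht hst x => ?_⟩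
    have hd := (h s ⟨zero_le, hs⟩ t ⟨zero_le, ht⟩ (by linarith)).le
    rw [dist_eq_norm] at hd
    have hfin : R * (ε / (R + 1)) ≤ ε := by
      rw [← mul_div_assoc, div_le_iff₀ (by positivity)]
      nlinarith
    constructor
    · refine (norm_comp_kernel_sub_le hA hA2 Kv (toDual α (ν s)) (toDual α (ν t)) x).trans
        (le_trans ?_ hfin)
      gcongr
      have : 0 ≤ B * ‖Km‖ := by positivity
      linarith
    · refine (norm_comp_kernel_sub_le hB hB2 Km (toDual α (ν s)) (toDual α (ν t)) x).trans
        (le_trans ?_ hfin)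
      gcongr
      have : 0 ≤ A * ‖Kv‖ := by positivity
      linarith

/-- For a test function `f` constant in time the generator is `b · ∇f + w f`, at most `2 C ‖f‖`. -/
theorem HasEvolution.norm_toDual_sub_le {b : ℝ≥0 → Rd d → Rd d} {w : ℝ≥0 → Rd d → ℝ} {C V : ℝ}
    {μ₀ : M d} (hν : IsNarrowlyContinuous ν) (hbw : IsBoundedContinuousCoeff b w C)
    (h : HasEvolution b w μ₀ ν) {s t : ℝ≥0} (hst : s ≤ t)
    (hV : ∀ r ∈ Icc s t, totalMass (ν r) ≤ V) :
    ‖toDual α (ν t) - toDual α (ν s)‖ ≤ 2 * C * V * dist s t := by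
  have hC : 0 ≤ C := (norm_nonneg _).trans (hbw.norm_drift_le 0 0)
  have hV0 : 0 ≤ V := (totalMass_nonneg _).trans (hV s ⟨le_rfl, hst⟩)
  refine ContinuousLinearMap.opNorm_le_bound _ (by positivity) fun f => ?_
  have hf := f.isC1Holder.contDiff
  have hd : ∀ (r : ℝ) x, HasFDerivAt (fun p : ℝ × Rd d => f p.2)
      ((fderiv ℝ f x).comp (ContinuousLinearMap.snd ℝ ℝ (Rd d))) (r, x) := fun r x =>
    (hf.differentiable one_ne_zero x).hasFDerivAt.comp (r, x) hasFDerivAt_snd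
  have key := h.abs_integral_sub_le hν hbw (Ψ := fun p => f p.2) (hf.comp contDiff_snd) hst
    (fun r _ x => f.norm_apply_le x) (A₁ := 2 * C * ‖f‖) (fun r _ x => by
      have h1 : |fderiv ℝ f x (b r x)| ≤ ‖f‖ * C :=
        ((fderiv ℝ f x).le_of_opNorm_le (f.norm_fderiv_le x) _).trans
          (by gcongr; exact hbw.norm_drift_le r x)
      have h2 : |w r x * f x| ≤ C * ‖f‖ := by
        rw [abs_mul]
        exact mul_le_mul (hbw.abs_rate_le r x) (f.norm_apply_le x) (abs_nonneg _) hC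
      have e : generator b w (fun p => f p.2) r x = fderiv ℝ f x (b r x) + w r x * f x := by
        simp only [generator, (hd r x).fderiv]
        simp
      rw [e]
      refine (abs_add_le _ _).trans ?_
      linarith) hV
  have hdist : dist s t = (t : ℝ) - s := by
    rw [NNReal.dist_eq, abs_sub_comm, abs_of_nonneg (sub_nonneg.2 (NNReal.coe_le_coe.2 hst))]
  rw [hdist]
  calc _ ≤ 2 * C * ‖f‖ * V * (t - s) := key
    _ = _ := by ring

theorem HasEvolution.continuous_toDual {b : ℝ≥0 → Rd d → Rd d} {w : ℝ≥0 → Rd d → ℝ} {C : ℝ}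
    {μ₀ : M d} (hν : IsNarrowlyContinuous ν) (hbw : IsBoundedContinuousCoeff b w C)
    (h : HasEvolution b w μ₀ ν) : Continuous fun t => toDual α (ν t) := by
  rw [continuous_iff_continuousAt]
  intro t₀
  obtain ⟨V, hV⟩ := hν.exists_totalMass_le (t₀ + 1)
  rw [ContinuousAt, tendsto_iff_dist_tendsto_zero]
  have hlim : Tendsto (fun t => 2 * C * V * dist t t₀) (𝓝 t₀) (𝓝 0) := by
    have hc : Continuous fun t => 2 * C * V * dist t t₀ := by fun_prop
    simpa using hc.tendsto t₀
  refine squeeze_zero' (Eventually.of_forall fun _ => dist_nonneg) ?_ hlim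
  filter_upwards [gt_mem_nhds (show t₀ < t₀ + 1 by simp)] with t ht
  rcases le_total t t₀ with htt | htt
  · rw [dist_comm, dist_eq_norm]
    exact h.norm_toDual_sub_le hν hbw htt fun r hr => hV r (hr.2.trans (by simp))
  · rw [dist_eq_norm, dist_comm t t₀]
    exact h.norm_toDual_sub_le hν hbw htt fun r hr => hV r (hr.2.trans ht.le)

end Coefficients

end NonlinearTransport

/-! ### The equivalence -/

theorem proposition4p1 (d : ℕ) (α : ℝ) (hα : 0 < α) (hα' : α ≤ 1)
    (v₀ : ℝ → Rd d) (hv₀ : IsC2Holder α v₀) (m₀ : ℝ → ℝ) (hm₀ : IsC2Holder α m₀)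
    (Kv : HolderSpace α (Rd d) (HolderSpace α (Rd d) ℝ)) (hKv : IsWeaklyContinuousBounded Kv)
    (Km : HolderSpace α (Rd d) (HolderSpace α (Rd d) ℝ)) (hKm : IsWeaklyContinuousBounded Km)
    (μ₀ : M d) (ν : ℝ≥0 → M d) :
    IsNonlinearWeakSolution v₀ m₀ Kv Km μ₀ ν ↔
      Continuous (fun t => measureToZ α (ν t)) ∧ ν 0 = μ₀ ∧
        opT v₀ m₀ Kv Km μ₀ (fun t => measureToZ α (ν t)) = Part.some (fun t => measureToZ α (ν t)) := by
  constructor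
  · rintro ⟨hν, hweak⟩
    obtain ⟨C, hbw⟩ := exists_isBoundedContinuousCoeff (Kv := Kv) (Km := Km) hv₀ hm₀ hν
    have hev := hweak.hasEvolution hν hbw
    have hcont : Continuous fun t => toDual α (ν t) := hev.continuous_toDual hν hbw
    have hc1 := isC1Coeff_kernel (Kv := Kv) (Km := Km) hv₀ hm₀ hcont
    have hlin : IsLinearWeakSolution (fun t x => v₀ (kernelIntegral Kv (ν t) x))
        (fun t x => m₀ (kernelIntegral Km (ν t) x)) μ₀ ν :=
      ⟨hν, fun φ hφ => hweak φ (hφ.of_le (by norm_cast))⟩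
    have hunique : ∀ ν', IsLinearWeakSolution (fun t x => v₀ (kernelIntegral Kv (ν t) x))
        (fun t x => m₀ (kernelIntegral Km (ν t) x)) μ₀ ν' → ν' = ν := by
      rintro ν' ⟨hν', hweak'⟩
      have hev' := (hweak'.of_smooth hν' hbw).hasEvolution hν' hbw
      have hsub := hev'.sub hν' hν hbw hev
      rw [sub_self] at hsub
      funext t
      exact sub_eq_zero.1 (hsub.eq_zero (hν'.sub hν) hbw hc1 t)
    refine ⟨hcont.subtype_mk _, hev.initial_eq, ?_⟩
    -- On measures the pairing with the kernel is the kernel integral by definition, so `hlin` and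
    -- `hunique` apply unchanged to the coefficients from `opB`.
    have hdom : ∃! ν' : ℝ≥0 → M d, IsLinearWeakSolution
        (opB v₀ m₀ Kv Km fun t => measureToZ α (ν t)).1
        (opB v₀ m₀ Kv Km fun t => measureToZ α (ν t)).2 μ₀ ν' := ⟨ν, hlin, hunique⟩
    refine Part.eq_some_iff.2 ⟨hdom, ?_⟩
    change (fun t => measureToZ α (hdom.choose t)) = _
    rw [hunique _ hdom.choose_spec.1]
  · rintro ⟨-, -, hfix⟩
    obtain ⟨hdom, hget⟩ := Part.eq_some_iff.1 hfix
    -- The fixed-point equation holds in `Z`; injectivity of the embedding brings it back to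
    -- measures, so `ν` inherits narrow continuity and the smooth weak form.
    have hchoose : hdom.choose = ν := by
      funext t
      exact measureToZ_injective hα hα' (congrFun hget t)
    have hlin : IsLinearWeakSolution (fun t x => v₀ (kernelIntegral Kv (ν t) x))
        (fun t x => m₀ (kernelIntegral Km (ν t) x)) μ₀ ν := by
      have := hdom.choose_spec.1
      rwa [hchoose] at this
    obtain ⟨C, hbw⟩ := exists_isBoundedContinuousCoeff (Kv := Kv) (Km := Km) hv₀ hm₀ hlin.1
    exact ⟨hlin.1, hlin.2.of_smooth hlin.1 hbw⟩
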